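/- Let $f$ be a bounded analytic function on the strip $\mathbb{R}+i(-\pi,0)$, with boundary values $f(\theta)=\lim_{\lambda\uparrow 0}f(\theta+i\lambda)$ and $f(\theta-\pi i)=\lim_{\lambda\downarrow-\pi}f(\theta+i\lambda)$ (which exist for almost every $\theta\in\mathbb{R}$), and assume that $\overline{f(\theta)}=f(\theta-\pi i)$ for almost every $\theta$. Let $H^2$ be the space of analytic functions $\xi$ on $\mathbb{R}+i(-\pi,0)$ such that $\xi(\cdot+i\lambda)\in L^2(\mathbb{R})$ for each $\lambda\in(-\pi,0)$, with norms bounded uniformly in $\lambda$. Such a $\xi$ has boundary values $\xi(\theta)$ and $\xi(\theta-\pi i)$ as $L^2(\mathbb{R})$-limits of $\xi(\cdot+i\lambda)$ for $\lambda\uparrow0$ and $\lambda\downarrow-\pi$; it is identified with its boundary value $\xi(\theta)$, so that $H^2\subset L^2(\mathbb{R})$. Let $\Delta^{1/2}$ be the operator on $L^2(\mathbb{R})$ with domain $H^2$ and $(\Delta^{1/2}\xi)(\theta)=\xi(\theta-\pi i)$, and let $M_{\bar f}$ be the operator of multiplication by $\overline{f(\theta)}$ on $L^2(\mathbb{R})$.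 If there is $r>0$ such that $|\overline{f(\theta)}-r|\le r$ for almost every $\theta\in\mathbb{R}$, then the operator $M_{\bar f}\Delta^{1/2}$, with domain $H^2$, is essentially self-adjoint; that is, it is densely defined, symmetric and closable, and its closure is self-adjoint. -/

import Mathlib

open MeasureTheory Filter Topology Set
open scoped ENNReal LinearPMap

noncomputable section

namespace BoundState

/-- The Hilbert space `L²(ℝ)` of complex functions with respect to Lebesgue measure. -/
abbrev L2 : Type := Lp ℂ 2 (volume : Measure ℝ)

/-- The open horizontal strip `ℝ + i(a,b)`. -/
def strip (a b : ℝ) : Set ℂ := {z | a < z.im ∧ z.im < b}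

/-- The horizontal slice `θ ↦ ξ(θ + iy)`. -/
def slice (ξ : ℂ → ℂ) (y : ℝ) (θ : ℝ) : ℂ := ξ (θ + y * Complex.I)

/-- The Hardy space `H²` of the strip `ℝ + i(a,b)`: analytic functions on the strip whose horizontal
slices are square integrable with uniformly bounded norms. (The values of `ξ` off the strip
are irrelevant.) -/
structure IsHardyTwo (a b : ℝ) (ξ : ℂ → ℂ) : Prop where
  analytic : DifferentiableOn ℂ ξ (strip a b)
  memLp : ∀ y ∈ Ioo a b, MemLp (slice ξ y) 2 volume
  bounded : ∃ C : ℝ≥0∞, C ≠ ∞ ∧ ∀ y ∈ Ioo a b, eLpNorm (slice ξ y) 2 volume ≤ C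

/-- The Hardy space `H^∞` of the strip `ℝ + i(a,b)`: bounded analytic functions on the strip. -/
structure IsHardyInfty (a b : ℝ) (f : ℂ → ℂ) : Prop where
  analytic : DifferentiableOn ℂ f (strip a b)
  bounded : ∃ C : ℝ, ∀ z ∈ strip a b, ‖f z‖ ≤ C

/-- The slices `ξ(· + iy)` converge in `L²(ℝ)` to `u` along the filter `l`. -/
def SliceTendsto (ξ : ℂ → ℂ) (l : Filter ℝ) (u : L2) : Prop :=
  Tendsto (fun y => eLpNorm (fun θ => slice ξ y θ - u θ) 2 volume) l (𝓝 0)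

/-- The pair `(u, v)` consists of the boundary values `u = ξ(·)` and `v = ξ(· - πi)`, as limits
in `L²(ℝ)`, of some `ξ` in the Hardy space `H²` of the strip `ℝ + i(-π,0)`. -/
def IsBoundaryPair (u v : L2) : Prop :=
  ∃ ξ : ℂ → ℂ, IsHardyTwo (-Real.pi) 0 ξ ∧
    SliceTendsto ξ (𝓝[<] 0) u ∧ SliceTendsto ξ (𝓝[>] (-Real.pi)) v

theorem memLp_slice_sub {ξ : ℂ → ℂ} (h : IsHardyTwo (-Real.pi) 0 ξ) {y : ℝ}
    (hy : y ∈ Ioo (-Real.pi) 0) (u : L2) :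
    MemLp (fun θ => slice ξ y θ - u θ) 2 volume :=
  (h.memLp y hy).sub (Lp.memLp u)

theorem eventually_top : ∀ᶠ y in 𝓝[<] (0 : ℝ), y ∈ Ioo (-Real.pi) 0 :=
  Ioo_mem_nhdsLT (neg_lt_zero.mpr Real.pi_pos)

theorem eventually_bot : ∀ᶠ y in 𝓝[>] (-Real.pi), y ∈ Ioo (-Real.pi) 0 :=
  Ioo_mem_nhdsGT (neg_lt_zero.mpr Real.pi_pos)

theorem SliceTendsto.add {ξ η : ℂ → ℂ} {l : Filter ℝ} {u w : L2}
    (hξ : IsHardyTwo (-Real.pi) 0 ξ) (hη : IsHardyTwo (-Real.pi) 0 η)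
    (hl : ∀ᶠ y in l, y ∈ Ioo (-Real.pi) 0)
    (h1 : SliceTendsto ξ l u) (h2 : SliceTendsto η l w) :
    SliceTendsto (ξ + η) l (u + w) := by
  have h0 := Tendsto.add h1 h2
  rw [add_zero] at h0
  refine tendsto_of_tendsto_of_tendsto_of_le_of_le' tendsto_const_nhds h0
    (Eventually.of_forall fun _ => zero_le) ?_
  filter_upwards [hl] with y hy
  calc eLpNorm (fun θ => slice (ξ + η) y θ - (u + w : L2) θ) 2 volume
      = eLpNorm ((fun θ => slice ξ y θ - u θ) + fun θ => slice η y θ - w θ) 2 volume := by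
        refine eLpNorm_congr_ae ?_
        filter_upwards [Lp.coeFn_add u w] with θ hθ
        rw [hθ]
        simp only [slice, Pi.add_apply]
        ring
    _ ≤ _ := eLpNorm_add_le (memLp_slice_sub hξ hy u).1 (memLp_slice_sub hη hy w).1 (by norm_num)

theorem SliceTendsto.smul {ξ : ℂ → ℂ} {l : Filter ℝ} {u : L2} (c : ℂ)
    (h1 : SliceTendsto ξ l u) : SliceTendsto (c • ξ) l (c • u) := by
  have h0 := ENNReal.Tendsto.const_mul (a := ‖c‖ₑ) h1 (Or.inr enorm_ne_top)
  rw [mul_zero] at h0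
  refine h0.congr fun y => ?_
  rw [← eLpNorm_const_smul]
  refine eLpNorm_congr_ae ?_
  filter_upwards [Lp.coeFn_smul c u] with θ hθ
  rw [hθ]
  simp only [slice, Pi.smul_apply, smul_eq_mul]
  ring

theorem IsHardyTwo.zero (a b : ℝ) : IsHardyTwo a b 0 where
  analytic := differentiableOn_const 0
  memLp _ _ := MemLp.zero
  bounded := ⟨0, by simp, fun _ _ => (eLpNorm_zero (α := ℝ) (ε := ℂ)).le⟩

theorem IsHardyTwo.add {a b : ℝ} {ξ η : ℂ → ℂ} (hξ : IsHardyTwo a b ξ) (hη : IsHardyTwo a b η) :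
    IsHardyTwo a b (ξ + η) where
  analytic := hξ.analytic.add hη.analytic
  memLp y hy := (hξ.memLp y hy).add (hη.memLp y hy)
  bounded := by
    obtain ⟨C, hC, h1⟩ := hξ.bounded
    obtain ⟨D, hD, h2⟩ := hη.bounded
    refine ⟨C + D, by simp [hC, hD], fun y hy => ?_⟩
    exact (eLpNorm_add_le (hξ.memLp y hy).1 (hη.memLp y hy).1 (by norm_num)).trans
      (add_le_add (h1 y hy) (h2 y hy))

theorem IsHardyTwo.smul {a b : ℝ} {ξ : ℂ → ℂ} (c : ℂ) (hξ : IsHardyTwo a b ξ) :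
    IsHardyTwo a b (c • ξ) where
  analytic := hξ.analytic.const_smul c
  memLp y hy := (hξ.memLp y hy).const_smul c
  bounded := by
    obtain ⟨C, hC, h1⟩ := hξ.bounded
    refine ⟨‖c‖ₑ * C, ENNReal.mul_ne_top enorm_ne_top hC, fun y hy => ?_⟩
    have : slice (c • ξ) y = c • slice ξ y := rfl
    rw [this, eLpNorm_const_smul]
    gcongr
    exact h1 y hy

/-- The graph of the analytic continuation operator: all pairs `(ξ(·), ξ(· - πi))` for `ξ` in the
Hardy space `H²` of the strip `ℝ + i(-π,0)`. -/
def shiftGraph : Submodule ℂ (L2 × L2) where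
  carrier := {p | IsBoundaryPair p.1 p.2}
  add_mem' := by
    rintro ⟨u, v⟩ ⟨u', v'⟩ ⟨ξ, h, h1, h2⟩ ⟨η, k, k1, k2⟩
    exact ⟨ξ + η, h.add k, h1.add h k eventually_top k1, h2.add h k eventually_bot k2⟩
  zero_mem' := by
    refine ⟨0, IsHardyTwo.zero _ _, ?_, ?_⟩ <;>
    · refine tendsto_const_nhds.congr fun y => ?_
      rw [eq_comm, ← eLpNorm_zero (α := ℝ) (ε := ℂ) (p := 2) (μ := volume)]
      refine eLpNorm_congr_ae ?_
      filter_upwards [Lp.coeFn_zero ℂ 2 (volume : Measure ℝ)] with θ hθ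
      simp only [Prod.fst_zero, Prod.snd_zero, hθ, slice, Pi.zero_apply, sub_zero]
  smul_mem' := by
    rintro c ⟨u, v⟩ ⟨ξ, h, h1, h2⟩
    exact ⟨c • ξ, h.smul c, h1.smul c, h2.smul c⟩

/-- Moving horizontally does not change the imaginary part. -/
theorem add_ofReal_mem_strip {a b : ℝ} {z : ℂ} (hz : z ∈ strip a b) (s : ℝ) :
    z + (s : ℂ) ∈ strip a b := by
  simpa [strip] using hz

theorem isOpen_strip (a b : ℝ) : IsOpen (strip a b) :=
  (isOpen_lt continuous_const Complex.continuous_im).inter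
    (isOpen_lt Complex.continuous_im continuous_const)

/-- The horizontal moving integral `∫₀ʰ ξ(z + s) ds`. -/
def moving (ξ : ℂ → ℂ) (h : ℝ) (z : ℂ) : ℂ := ∫ s in (0 : ℝ)..h, ξ (z + s)

theorem differentiableOn_moving {a b : ℝ} {ξ : ℂ → ℂ} (hξ : DifferentiableOn ℂ ξ (strip a b))
    (h : ℝ) : DifferentiableOn ℂ (moving ξ h) (strip a b) := by
  intro z hz
  have ho := isOpen_strip a b
  have hd : ContinuousOn (deriv ξ) (strip a b) := (hξ.deriv ho).continuousOn
  obtain ⟨ε, hε, hball⟩ := Metric.isOpen_iff.1 ho z hz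
  set K : Set ℂ := (fun p : ℂ × ℝ => p.1 + (p.2 : ℂ)) '' (Metric.closedBall z (ε / 2) ×ˢ uIcc 0 h)
  have hK : IsCompact K :=
    ((isCompact_closedBall z (ε / 2)).prod isCompact_uIcc).image (by fun_prop)
  have hKs : K ⊆ strip a b := by
    rintro _ ⟨⟨w, s⟩, ⟨hw, -⟩, rfl⟩
    exact add_ofReal_mem_strip
      (hball (Metric.closedBall_subset_ball (by linarith) hw)) s
  obtain ⟨C, hC⟩ := hK.exists_bound_of_continuousOn (hd.mono hKs)
  have hslice : ∀ {g : ℂ → ℂ}, ContinuousOn g (strip a b) → ∀ w ∈ strip a b,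
      Continuous fun s : ℝ => g (w + s) := fun {g} hg w hw =>
    hg.comp_continuous (by fun_prop) fun s => add_ofReal_mem_strip hw s
  have key := intervalIntegral.hasDerivAt_integral_of_dominated_loc_of_deriv_le
    (𝕜 := ℂ) (μ := volume) (a := 0) (b := h) (F := fun w (s : ℝ) => ξ (w + s))
    (F' := fun w (s : ℝ) => deriv ξ (w + s)) (x₀ := z) (s := Metric.ball z (ε / 2))
    (bound := fun _ => C)
    (Metric.ball_mem_nhds z (by positivity))
    (by
      filter_upwards [ho.mem_nhds hz] with w hw
      exact (hslice hξ.continuousOn w hw).aestronglyMeasurable)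
    ((hslice hξ.continuousOn z hz).intervalIntegrable _ _)
    (hslice hd z hz).aestronglyMeasurable
    (Eventually.of_forall fun s hs w hw => hC _
      ⟨(w, s), ⟨Metric.ball_subset_closedBall hw, uIoc_subset_uIcc hs⟩, rfl⟩)
    (by simp)
    (Eventually.of_forall fun s hs w hw => by
      have hw' : w + (s : ℂ) ∈ strip a b :=
        add_ofReal_mem_strip (hball (Metric.ball_subset_ball (by linarith) hw)) s
      have := (hξ.differentiableAt (ho.mem_nhds hw')).hasDerivAt
      exact this.comp_add_const w (s : ℂ))
  exact key.2.differentiableAt.differentiableWithinAt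

theorem norm_moving_le {a b : ℝ} {ξ : ℂ → ℂ} (hξ : IsHardyTwo a b ξ) {h : ℝ} (hh : 0 ≤ h)
    {z : ℂ} (hz : z ∈ strip a b) :
    ‖moving ξ h z‖ₑ ≤ eLpNorm (slice ξ z.im) 2 volume * ENNReal.ofReal h ^ (1 / 2 : ℝ) := by
  have hc : Continuous fun s : ℝ => ξ (z + s) :=
    hξ.analytic.continuousOn.comp_continuous (by fun_prop) fun s => add_ofReal_mem_strip hz s
  have h1 : (fun s : ℝ => ξ (z + s)) = (slice ξ z.im) ∘ fun s => z.re + s := by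
    ext s
    simp only [slice, Function.comp]
    congr 1
    apply Complex.ext <;> simp
  have h2 : eLpNorm (fun s : ℝ => ξ (z + s)) 2 volume = eLpNorm (slice ξ z.im) 2 volume := by
    rw [h1]
    exact eLpNorm_comp_measurePreserving (hξ.memLp _ hz).1
      (measurePreserving_add_left volume z.re)
  rw [moving, intervalIntegral.integral_of_le hh]
  calc _ ≤ ∫⁻ s in Ioc 0 h, ‖ξ (z + s)‖ₑ := enorm_integral_le_lintegral_enorm _
    _ = eLpNorm (fun s : ℝ => ξ (z + s)) 1 (volume.restrict (Ioc 0 h)) := by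
        rw [eLpNorm_one_eq_lintegral_enorm]
    _ ≤ eLpNorm (fun s : ℝ => ξ (z + s)) 2 (volume.restrict (Ioc 0 h)) *
          (volume.restrict (Ioc 0 h)) univ ^ (1 / (1 : ℝ≥0∞).toReal - 1 / (2 : ℝ≥0∞).toReal) :=
        eLpNorm_le_eLpNorm_mul_rpow_measure_univ (by norm_num) hc.aestronglyMeasurable
    _ ≤ _ := by
        gcongr
        · exact (eLpNorm_mono_measure _ Measure.restrict_le_self).trans h2.le
        · simp only [Measure.restrict_apply_univ, Real.volume_Ioc, sub_zero,
            ENNReal.toReal_one, ENNReal.toReal_ofNat]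
          norm_num

/-- A function in `H²` of the strip `ℝ + i(a,b)` whose boundary value on `ℝ + ib` vanishes
is zero. -/
theorem IsHardyTwo.eq_zero {a b : ℝ} {ξ : ℂ → ℂ} (hξ : IsHardyTwo a b ξ)
    (h0 : Tendsto (fun y => eLpNorm (slice ξ y) 2 volume) (𝓝[<] b) (𝓝 0)) :
    ∀ z ∈ strip a b, ξ z = 0 := by
  obtain ⟨C, hC, hb⟩ := hξ.bounded
  have hmov : ∀ h : ℝ, 0 ≤ h → ∀ z ∈ strip a b, moving ξ h z = 0 := by
    intro h hh z hz
    set M : ℝ≥0∞ := ENNReal.ofReal h ^ (1 / 2 : ℝ) with hM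
    have hMt : M ≠ ∞ := ENNReal.rpow_ne_top_of_nonneg (by norm_num) ENNReal.ofReal_ne_top
    set A : ℝ := (C * M).toReal
    set N : ℝ → ℝ := fun u => (eLpNorm (slice ξ u) 2 volume * M).toReal with hN
    have hfin : ∀ y ∈ Ioo a b, eLpNorm (slice ξ y) 2 volume * M ≠ ∞ := fun y hy =>
      ENNReal.mul_ne_top (hξ.memLp y hy).2.ne hMt
    have hle : ∀ w ∈ strip a b, ‖moving ξ h w‖ ≤ N w.im := fun w hw => by
      rw [← toReal_enorm]
      exact ENNReal.toReal_mono (hfin _ hw) (norm_moving_le hξ hh hw)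
    have hNA : ∀ y ∈ Ioo a b, N y ≤ A := fun y hy =>
      ENNReal.toReal_mono (ENNReal.mul_ne_top hC hMt) (by gcongr; exact hb y hy)
    have hN0 : Tendsto N (𝓝[<] b) (𝓝 0) := by
      have := ENNReal.Tendsto.mul_const (b := M) h0 (Or.inr hMt)
      rw [zero_mul] at this
      exact (ENNReal.tendsto_toReal ENNReal.zero_ne_top).comp this
    obtain ⟨hz1, hz2⟩ := hz
    obtain ⟨l, hal, hlz⟩ := exists_between hz1
    have hthree : ∀ᶠ u in 𝓝[<] b, ‖moving ξ h z‖ ≤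
        A ^ (1 - (z.im - l) / (u - l)) * N u ^ ((z.im - l) / (u - l)) := by
      filter_upwards [Ioo_mem_nhdsLT hz2] with u hu
      have hmem : ∀ w ∈ Complex.HadamardThreeLines.verticalClosedStrip l u,
          Complex.I * w ∈ strip a b := fun w hw => by
        simp only [Complex.HadamardThreeLines.verticalClosedStrip, mem_preimage, mem_Icc] at hw
        refine ⟨?_, ?_⟩ <;> simp <;> linarith [hw.1, hw.2, hu.2]
      have hdiff : DifferentiableOn ℂ (fun w => moving ξ h (Complex.I * w))
          (Complex.HadamardThreeLines.verticalClosedStrip l u) :=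
        (differentiableOn_moving hξ.analytic h).comp (by fun_prop) hmem
      have := Complex.HadamardThreeLines.norm_le_interp_of_mem_verticalClosedStrip'
        (f := fun w => moving ξ h (Complex.I * w)) (z := -Complex.I * z) (a := A) (b := N u)
        (hlz.trans hu.1)
        (by simp [Complex.HadamardThreeLines.verticalClosedStrip, hlz.le, hu.1.le])
        (DifferentiableOn.diffContOnCl (hdiff.mono (by
          refine closure_minimal ?_ (isClosed_Icc.preimage Complex.continuous_re)
          exact preimage_mono Ioo_subset_Icc_self)))
        (by
          refine ⟨A, ?_⟩
          rintro _ ⟨w, hw, rfl⟩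
          exact (hle _ (hmem w hw)).trans (hNA _ (hmem w hw)))
        (fun w hw => by
          have hw' : w ∈ Complex.HadamardThreeLines.verticalClosedStrip l u := by
            simp only [mem_preimage, mem_singleton_iff] at hw
            simp [Complex.HadamardThreeLines.verticalClosedStrip, hw, (hlz.trans hu.1).le]
          exact (hle _ (hmem w hw')).trans (hNA _ (hmem w hw')))
        (fun w hw => by
          have hw1 : w.re = u := hw
          have hw' : w ∈ Complex.HadamardThreeLines.verticalClosedStrip l u := by
            simp [Complex.HadamardThreeLines.verticalClosedStrip, hw1, (hlz.trans hu.1).le]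
          have := hle _ (hmem w hw')
          simpa [hw1] using this)
      have e1 : Complex.I * (-Complex.I * z) = z := by
        rw [← mul_assoc, mul_neg, Complex.I_mul_I]; simp
      have e2 : (-Complex.I * z).re = z.im := by simp
      simpa only [e1, e2] using this
    have ht : Tendsto (fun u => (z.im - l) / (u - l)) (𝓝[<] b) (𝓝 ((z.im - l) / (b - l))) :=
      ((continuousAt_const.div (continuousAt_id.sub continuousAt_const)
        (sub_ne_zero.2 (hlz.trans hz2).ne')).tendsto).mono_left nhdsWithin_le_nhds
    have hpos : 0 < (z.im - l) / (b - l) := div_pos (by linarith) (by linarith)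
    have hlim : Tendsto (fun u => A ^ (1 - (z.im - l) / (u - l)) * N u ^ ((z.im - l) / (u - l)))
        (𝓝[<] b) (𝓝 0) := by
      have k1 : Tendsto (fun u => N u ^ ((z.im - l) / (u - l))) (𝓝[<] b) (𝓝 0) := by
        have := (Real.continuousAt_rpow_of_pos (0, (z.im - l) / (b - l)) hpos).tendsto.comp
          (hN0.prodMk_nhds ht)
        simp only [Real.zero_rpow hpos.ne'] at this
        exact this
      rcases (ENNReal.toReal_nonneg : 0 ≤ A).eq_or_lt with hA | hA
      · refine tendsto_of_tendsto_of_tendsto_of_le_of_le' tendsto_const_nhds k1 ?_ ?_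
        · exact Eventually.of_forall fun u => mul_nonneg (Real.rpow_nonneg hA.le _)
            (Real.rpow_nonneg ENNReal.toReal_nonneg _)
        · refine Eventually.of_forall fun u => ?_
          refine mul_le_of_le_one_left (Real.rpow_nonneg ENNReal.toReal_nonneg _) ?_
          have hA' : A = 0 := hA.symm
          rw [hA']
          exact Real.zero_rpow_le_one _
      · have k2 : Tendsto (fun u => A ^ (1 - (z.im - l) / (u - l))) (𝓝[<] b)
            (𝓝 (A ^ (1 - (z.im - l) / (b - l)))) :=
          (tendsto_const_nhds (x := A)).rpow (tendsto_const_nhds.sub ht) (Or.inl hA.ne')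
        simpa using k2.mul k1
    exact norm_le_zero_iff.1 (ge_of_tendsto hlim hthree)
  intro z hz
  have hc : Continuous fun s : ℝ => ξ (z + s) :=
    hξ.analytic.continuousOn.comp_continuous (by fun_prop) fun s => add_ofReal_mem_strip hz s
  have hd : HasDerivAt (fun h => moving ξ h z) (ξ (z + (0 : ℝ))) 0 :=
    intervalIntegral.integral_hasDerivAt_right (hc.intervalIntegrable _ _)
      (hc.stronglyMeasurableAtFilter _ _) hc.continuousAt
  have hd0 : HasDerivWithinAt (fun h => moving ξ h z) 0 (Ici 0) 0 :=
    (hasDerivWithinAt_const (0 : ℝ) (Ici 0) (0 : ℂ)).congr (fun h hh => hmov h hh z hz)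
      (hmov 0 le_rfl z hz)
  simpa using (uniqueDiffWithinAt_Ici (0 : ℝ)).eq_deriv _ hd.hasDerivWithinAt hd0

/-- The boundary value on `ℝ` determines the one on `ℝ - πi`: `shiftGraph` is the graph of an
operator. -/
theorem shiftGraph_single_valued (p : L2 × L2) (hp : p ∈ shiftGraph) (h0 : p.1 = 0) :
    p.2 = 0 := by
  obtain ⟨ξ, hξ, h1, h2⟩ := hp
  have hz : ∀ z ∈ strip (-Real.pi) 0, ξ z = 0 := by
    refine hξ.eq_zero (h1.congr fun y => eLpNorm_congr_ae ?_)
    rw [h0]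
    filter_upwards [Lp.coeFn_zero ℂ 2 (volume : Measure ℝ)] with θ hθ
    rw [hθ, Pi.zero_apply, sub_zero]
  have h3 : Tendsto (fun _ : ℝ => eLpNorm p.2 2 volume) (𝓝[>] (-Real.pi)) (𝓝 0) := by
    refine h2.congr' ?_
    filter_upwards [eventually_bot] with y hy
    rw [← eLpNorm_neg]
    refine eLpNorm_congr_ae (Eventually.of_forall fun θ => ?_)
    have : slice ξ y θ = 0 := hz _ (by simpa [strip] using hy)
    simp [this]
  have h4 : eLpNorm p.2 2 volume = 0 := tendsto_nhds_unique tendsto_const_nhds h3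
  rw [eLpNorm_eq_zero_iff (Lp.aestronglyMeasurable _) (by norm_num)] at h4
  exact (Lp.eq_zero_iff_ae_eq_zero).2 h4

/-- The operator `Δ^{1/2}` of analytic continuation: its domain is the Hardy space `H²` of the strip
`ℝ + i(-π,0)`, seen inside `L²(ℝ)` through the boundary values `ξ(θ)`, and it maps `ξ(θ)` to
`ξ(θ - πi)`. By `shiftGraph_single_valued` its graph is exactly `shiftGraph`. -/
def sqrtDelta : L2 →ₗ.[ℂ] L2 := shiftGraph.toLinearPMap

theorem mem_graph_sqrtDelta (u v : L2) : (u, v) ∈ sqrtDelta.graph ↔ IsBoundaryPair u v := by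
  rw [sqrtDelta, Submodule.toLinearPMap_graph_eq _ shiftGraph_single_valued]
  rfl

/-- The operator `M_g` of multiplication by `g` on `L²(ℝ)`, with its natural domain; it is an
everywhere defined bounded operator when `g` is essentially bounded and measurable. -/
def mulOp (g : ℝ → ℂ) : L2 →ₗ.[ℂ] L2 where
  domain :=
    { carrier := {u | MemLp (fun θ => g θ * u θ) 2 volume}
      add_mem' := fun {u v} hu hv => by
        refine (MemLp.add hu hv).ae_eq ?_
        filter_upwards [Lp.coeFn_add u v] with θ hθ
        simp only [hθ, Pi.add_apply, mul_add]
      zero_mem' := by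
        refine (MemLp.zero (ε := ℂ)).ae_eq ?_
        filter_upwards [Lp.coeFn_zero ℂ 2 (volume : Measure ℝ)] with θ hθ
        simp only [hθ, Pi.zero_apply, mul_zero]
      smul_mem' := fun c u hu => by
        refine (MemLp.const_smul hu c).ae_eq ?_
        filter_upwards [Lp.coeFn_smul c u] with θ hθ
        simp only [hθ, Pi.smul_apply, smul_eq_mul]
        ring }
  toFun :=
    { toFun := fun u => MemLp.toLp (fun θ => g θ * (u : L2) θ) u.2
      map_add' := fun u v => by
        rw [← MemLp.toLp_add]
        refine MemLp.toLp_congr _ _ ?_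
        filter_upwards [Lp.coeFn_add (u : L2) (v : L2)] with θ hθ
        simp only [Submodule.coe_add, hθ, Pi.add_apply, mul_add]
      map_smul' := fun c u => by
        rw [RingHom.id_apply, ← MemLp.toLp_const_smul]
        refine MemLp.toLp_congr _ _ ?_
        filter_upwards [Lp.coeFn_smul c (u : L2)] with θ hθ
        simp only [Submodule.coe_smul, hθ, Pi.smul_apply, smul_eq_mul]
        ring }

/-- The product `B A` of unbounded operators, with domain `{x ∈ dom A | A x ∈ dom B}`. -/
def opMul (B A : L2 →ₗ.[ℂ] L2) : L2 →ₗ.[ℂ] L2 where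
  domain :=
    { carrier := {x | ∃ hx : x ∈ A.domain, A ⟨x, hx⟩ ∈ B.domain}
      add_mem' := by
        rintro x y ⟨hx, hx'⟩ ⟨hy, hy'⟩
        refine ⟨A.domain.add_mem hx hy, ?_⟩
        have : A ⟨x + y, A.domain.add_mem hx hy⟩ = A ⟨x, hx⟩ + A ⟨y, hy⟩ :=
          A.map_add ⟨x, hx⟩ ⟨y, hy⟩
        rw [this]
        exact B.domain.add_mem hx' hy'
      zero_mem' := by
        refine ⟨A.domain.zero_mem, ?_⟩
        have : A ⟨0, A.domain.zero_mem⟩ = 0 := A.map_zero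
        rw [this]
        exact B.domain.zero_mem
      smul_mem' := by
        rintro c x ⟨hx, hx'⟩
        refine ⟨A.domain.smul_mem c hx, ?_⟩
        have : A ⟨c • x, A.domain.smul_mem c hx⟩ = c • A ⟨x, hx⟩ := A.map_smul c ⟨x, hx⟩
        rw [this]
        exact B.domain.smul_mem c hx' }
  toFun :=
    { toFun := fun x => B ⟨A ⟨x, x.2.1⟩, x.2.2⟩
      map_add' := fun x y => by
        rw [← B.map_add]
        congr 1
        exact Subtype.ext (A.map_add ⟨x, x.2.1⟩ ⟨y, y.2.1⟩)
      map_smul' := fun c x => by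
        rw [RingHom.id_apply, ← B.map_smul]
        congr 1
        exact Subtype.ext (A.map_smul c ⟨x, x.2.1⟩) }

/-- The boundary value `f(θ) = lim f(θ + iy)` as `y → 0` from below. For bounded analytic `f` the
limit exists for almost every `θ`, so the default value of `limUnder` matters only on a null set. -/
def upperBoundary (f : ℂ → ℂ) (θ : ℝ) : ℂ := limUnder (𝓝[<] (0 : ℝ)) fun y => slice f y θ

/-- The boundary value `f(θ - πi) = lim f(θ + iy)` as `y → -π` from above. -/
def lowerBoundary (f : ℂ → ℂ) (θ : ℝ) : ℂ :=
  limUnder (𝓝[>] (-Real.pi)) fun y => slice f y θ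

/-- The operator `M_{f̄} Δ^{1/2}`, that is `ξ(θ) ↦ conj f(θ) · ξ(θ - πi)`. -/
def boundStateOp (f : ℂ → ℂ) : L2 →ₗ.[ℂ] L2 :=
  opMul (mulOp fun θ => starRingEnd ℂ (upperBoundary f θ)) sqrtDelta

/-- Essential self-adjointness: the operator is densely defined and symmetric (hence closable),
and its closure is self-adjoint. -/
structure IsEssentiallySelfAdjoint (T : L2 →ₗ.[ℂ] L2) : Prop where
  dense : Dense (T.domain : Set L2)
  symmetric : T.IsFormalAdjoint T
  closable : T.IsClosable
  selfAdjoint : T.closure† = T.closure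

end BoundState

end

/-! On H² write T = M_{f̄}Δ^{1/2} as A + B, with A = rΔ^{1/2} and B = (M_{f̄} − r)Δ^{1/2}. The disc
condition |f̄ − r| ≤ r gives ‖Bξ‖ ≤ ‖Aξ‖, so B is a perturbation of A of relative bound one with no
additive constant. This is the borderline case of Kato-Rellich, settled by Wüst's argument
(`denseRange_add_of_norm_le`): if A + iν has dense range, so has A + B + iν. With ν = ±r, a dense
domain and symmetry of T, this yields essential self-adjointness
(`LinearPMap.isClosable_and_adjoint_closure_eq`).

Symmetry of Δ^{1/2} is a contour shift: conj ξ(conj z − πi) · η(z) is analytic in the strip, with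
the same integral over every horizontal line, and the two edges give ⟨Δ^{1/2}ξ, η⟩ and ⟨ξ, Δ^{1/2}η⟩
(`inner_shift_symm`). Multiplication by f preserves H², and conj f(θ) = f(θ − πi) says that
Δ^{1/2}M_f = M_{f̄}Δ^{1/2} on H². Symmetry of T follows by moving f̄ across the inner product, and B
= T − A is then symmetric too.

The range of A + iν is tested on Gaussians. If u is orthogonal to it, the entire function U(z) = ∫
exp(−(θ−z)²) u(θ) dθ satisfies U(z − πi) = cU(z) with c = iν/r, so |c| = 1 and c ≠ 1. Thus |U| is
periodic and bounded, U is constant by Liouville, and hence zero; the transform is injective, so u =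
0.

The boundary values of f come from a Fatou theorem: a primitive of f is Lipschitz, its extension to
ℝ is differentiable almost everywhere, and a two constants estimate carries that derivative into the
strip. -/

noncomputable section

/-! ### Abstract perturbation theory and the criterion for essential self-adjointness. -/

section HilbertSpace

variable {H D : Type*} [NormedAddCommGroup H] [InnerProductSpace ℂ H]
  [AddCommGroup D] [Module ℂ D]

/-- For a symmetric pair `(x, y)`, the norm of `y + iμx` is given by Pythagoras. -/
theorem norm_add_I_smul_sq {x y : H} (h : inner ℂ y x = inner ℂ x y) (μ : ℝ) :
    ‖y + (μ * Complex.I) • x‖ ^ 2 = ‖y‖ ^ 2 + μ ^ 2 * ‖x‖ ^ 2 := by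
  have h0 : (inner ℂ y x : ℂ).im = 0 := by
    have := congrArg Complex.im (inner_conj_symm (𝕜 := ℂ) y x)
    rw [← h] at this
    simp only [Complex.conj_im] at this
    linarith
  rw [norm_add_sq (𝕜 := ℂ), inner_smul_right]
  simp [norm_smul, mul_pow, h0]

/-- One term of Pythagoras is dropped. Together with the next bound, `y + iμx` controls both
components of a symmetric pair. -/
theorem norm_mul_le_norm_add_I_smul {x y : H} (h : inner ℂ y x = inner ℂ x y) (μ : ℝ) :
    |μ| * ‖x‖ ≤ ‖y + (μ * Complex.I) • x‖ := by
  refine abs_le_of_sq_le_sq' ?_ (norm_nonneg _) |>.2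
  rw [norm_add_I_smul_sq h, mul_pow, sq_abs]
  nlinarith [sq_nonneg ‖y‖]

theorem norm_le_norm_add_I_smul {x y : H} (h : inner ℂ y x = inner ℂ x y) (μ : ℝ) :
    ‖y‖ ≤ ‖y + (μ * Complex.I) • x‖ := by
  refine abs_le_of_sq_le_sq' ?_ (norm_nonneg _) |>.2
  rw [norm_add_I_smul_sq h]
  nlinarith [mul_nonneg (sq_nonneg μ) (sq_nonneg ‖x‖)]

/-- A linear map whose range is orthogonal only to zero has dense range. -/
theorem denseRange_of_inner_eq_zero [CompleteSpace H] (L : D →ₗ[ℂ] H)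
    (h : ∀ u : H, (∀ x, inner ℂ (L x) u = 0) → u = 0) : DenseRange L := by
  have h1 : (LinearMap.range L).topologicalClosure = ⊤ := by
    rw [Submodule.topologicalClosure_eq_top_iff, Submodule.eq_bot_iff]
    intro u hu
    exact h u fun x => hu (L x) (LinearMap.mem_range_self L x)
  exact Submodule.dense_iff_topologicalClosure_eq_top.2 h1

/-- A vector on which a dense set of functionals is small vanishes. -/
theorem eq_zero_of_norm_inner_le {L : D →ₗ[ℂ] H} (hL : DenseRange L) {u : H} {t : ℝ} (ht : t < 1)
    (h : ∀ x, ‖inner ℂ (L x) u‖ ≤ t * ‖L x‖ * ‖u‖) : u = 0 := by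
  have h1 : ∀ v : H, ‖inner ℂ v u‖ ≤ t * ‖v‖ * ‖u‖ := fun v =>
    hL.induction_on v (isClosed_le (by fun_prop) (by fun_prop)) h
  have h2 := h1 u
  rw [inner_self_eq_norm_sq_to_K] at h2
  simp only [Complex.coe_algebraMap, norm_pow, Complex.norm_real, norm_norm] at h2
  have h3 : ‖u‖ ^ 2 ≤ 0 := by nlinarith [sq_nonneg ‖u‖]
  exact norm_eq_zero.1 (pow_eq_zero_iff two_ne_zero |>.1 (le_antisymm h3 (sq_nonneg _)))

/-- Kato-Rellich: the range condition survives perturbations of relative bound less than one. -/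
theorem denseRange_add_smul_of_norm_le [CompleteSpace H] {J A B : D →ₗ[ℂ] H}
    (hA : ∀ x, inner ℂ (A x) (J x) = inner ℂ (J x) (A x)) (hBA : ∀ x, ‖B x‖ ≤ ‖A x‖)
    {μ : ℝ} (hr : DenseRange (A + (μ * Complex.I) • J)) {t : ℝ} (ht0 : 0 ≤ t) (ht : t < 1) :
    DenseRange (A + (t : ℂ) • B + (μ * Complex.I) • J) := by
  -- For `u` orthogonal to the perturbed range, pairing `u` with `(A + iμJ)x` equals minus pairing
  -- it with `tBx`, and `‖tBx‖ ≤ t‖Ax‖ ≤ t‖(A + iμJ)x‖`. Since `t < 1` and these vectors are dense,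
  -- `u` vanishes.
  refine denseRange_of_inner_eq_zero _ fun u hu => eq_zero_of_norm_inner_le hr ht fun x => ?_
  have h1 : inner ℂ ((A + (μ * Complex.I) • J) x) u = - inner ℂ ((t : ℂ) • B x) u := by
    rw [eq_neg_iff_add_eq_zero, ← inner_add_left, ← hu x]
    congr 1
    simp only [LinearMap.add_apply, LinearMap.smul_apply]
    abel
  rw [h1, norm_neg]
  refine (norm_inner_le_norm _ _).trans ?_
  gcongr
  rw [norm_smul, Complex.norm_real, Real.norm_of_nonneg ht0]
  gcongr
  exact (hBA x).trans (norm_le_norm_add_I_smul (hA x) μ)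

/-- Wüst: the range condition survives symmetric perturbations of relative bound one. -/
theorem denseRange_add_of_norm_le [CompleteSpace H] {J A B : D →ₗ[ℂ] H} (hJ : DenseRange J)
    (hA : ∀ x, inner ℂ (A x) (J x) = inner ℂ (J x) (A x))
    (hB : ∀ x y, inner ℂ (B x) (J y) = inner ℂ (J x) (B y))
    (hBA : ∀ x, ‖B x‖ ≤ ‖A x‖) {μ : ℝ} (hμ : μ ≠ 0)
    (hr : DenseRange (A + (μ * Complex.I) • J)) :
    DenseRange (A + B + (μ * Complex.I) • J) := by
  refine denseRange_of_inner_eq_zero _ fun u hu => ?_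
  have hμ' : 0 < |μ| := abs_pos.2 hμ
  by_contra hne
  have hu0 : 0 < ‖u‖ := norm_pos_iff.2 hne
  -- approximate `u` by `J z`
  obtain ⟨z, hz⟩ := hJ.exists_dist_lt u (ε := ‖u‖ / 9) (by positivity)
  rw [dist_eq_norm] at hz
  -- estimate for each `t < 1`
  have key : ∀ t : ℝ, 0 ≤ t → t < 1 →
      ‖u‖ ^ 2 ≤ ‖u‖ * ((1 - t) * ‖u‖) + ‖u‖ / 9 * (4 * ‖u‖) +
        (1 - t) * (‖B z‖ * (2 * ‖u‖ / |μ|)) := by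
    intro t ht0 ht
    have hs : 0 < 1 - t := by linarith
    obtain ⟨x, hx⟩ := (denseRange_add_smul_of_norm_le hA hBA hr ht0 ht).exists_dist_lt u
      (ε := (1 - t) * ‖u‖) (by positivity)
    rw [dist_eq_norm] at hx
    have hsym : inner ℂ (A x + (t : ℂ) • B x) (J x) = inner ℂ (J x) (A x + (t : ℂ) • B x) := by
      simp only [inner_add_left, inner_add_right, inner_smul_left, inner_smul_right, hA, hB,
        Complex.conj_ofReal]
    set Y : H := A x + (t : ℂ) • B x with hY
    have hval : (A + (t : ℂ) • B + (μ * Complex.I) • J) x = Y + (μ * Complex.I) • J x := rfl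
    rw [hval] at hx
    have hn : ‖Y + (μ * Complex.I) • J x‖ ≤ 2 * ‖u‖ := by
      have := norm_le_norm_add_norm_sub' (Y + (μ * Complex.I) • J x) u
      rw [norm_sub_rev] at this
      nlinarith
    have hJx : ‖J x‖ ≤ 2 * ‖u‖ / |μ| := by
      rw [le_div_iff₀ hμ', mul_comm]
      exact (norm_mul_le_norm_add_I_smul hsym μ).trans hn
    -- `‖Ax‖ ≤ ‖Y‖ + t‖Bx‖ ≤ ‖Y‖ + t‖Ax‖`, so `Ax` may grow only like `1/(1 - t)`, while `Jx` stays
    -- bounded.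
    have hAx : (1 - t) * ‖A x‖ ≤ 2 * ‖u‖ := by
      have h1 : ‖A x‖ ≤ ‖Y‖ + t * ‖B x‖ := by
        have : A x = Y - (t : ℂ) • B x := by simp [hY]
        calc ‖A x‖ = ‖Y - (t : ℂ) • B x‖ := by rw [← this]
          _ ≤ ‖Y‖ + ‖(t : ℂ) • B x‖ := norm_sub_le _ _
          _ = _ := by rw [norm_smul, Complex.norm_real, Real.norm_of_nonneg ht0]
      have h2 := mul_le_mul_of_nonneg_left (hBA x) ht0
      have h3 := (norm_le_norm_add_I_smul hsym μ).trans hn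
      linarith
    have hBx : ‖((1 - t : ℝ) : ℂ) • B x‖ ≤ 2 * ‖u‖ := by
      rw [norm_smul, Complex.norm_real, Real.norm_of_nonneg hs.le]
      exact (mul_le_mul_of_nonneg_left (hBA x) hs.le).trans hAx
    have hdec : (A + B + (μ * Complex.I) • J) x =
        (Y + (μ * Complex.I) • J x) + ((1 - t : ℝ) : ℂ) • B x := by
      simp only [hY, LinearMap.add_apply, LinearMap.smul_apply, Complex.ofReal_sub,
        Complex.ofReal_one, sub_smul, one_smul]
      abel
    have horth := hu x
    rw [hdec, inner_add_left] at horth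
    have e1 : (inner ℂ u u : ℂ) = inner ℂ (u - (Y + (μ * Complex.I) • J x)) u -
        inner ℂ (((1 - t : ℝ) : ℂ) • B x) (u - J z) -
        ((1 - t : ℝ) : ℂ) * inner ℂ (J x) (B z) := by
      rw [← hB]
      simp only [inner_sub_left, inner_sub_right, inner_smul_left, Complex.conj_ofReal] at horth ⊢
      linear_combination horth
    have e2 : ‖(inner ℂ u u : ℂ)‖ = ‖u‖ ^ 2 := by
      rw [inner_self_eq_norm_sq_to_K]; simp
    rw [← e2, e1]
    refine (norm_sub_le _ _).trans (add_le_add ((norm_sub_le _ _).trans (add_le_add ?_ ?_)) ?_)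
    · refine (norm_inner_le_norm _ _).trans ?_
      rw [mul_comm]
      gcongr
    · refine (norm_inner_le_norm _ _).trans ?_
      rw [mul_comm]
      refine mul_le_mul hz.le (hBx.trans (by linarith)) (norm_nonneg _) (by positivity)
    · rw [norm_mul, Complex.norm_real, Real.norm_of_nonneg hs.le]
      refine mul_le_mul_of_nonneg_left ?_ hs.le
      refine (norm_inner_le_norm _ _).trans ?_
      rw [mul_comm]
      gcongr
  have hlim : Tendsto (fun t : ℝ => ‖u‖ * ((1 - t) * ‖u‖) + ‖u‖ / 9 * (4 * ‖u‖) +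
      (1 - t) * (‖B z‖ * (2 * ‖u‖ / |μ|))) (𝓝[<] 1) (𝓝 (‖u‖ / 9 * (4 * ‖u‖))) := by
    refine tendsto_nhdsWithin_of_tendsto_nhds ?_
    have : Continuous (fun t : ℝ => ‖u‖ * ((1 - t) * ‖u‖) + ‖u‖ / 9 * (4 * ‖u‖) +
      (1 - t) * (‖B z‖ * (2 * ‖u‖ / |μ|))) := by fun_prop
    simpa using this.tendsto 1
  have hfin : ‖u‖ ^ 2 ≤ ‖u‖ / 9 * (4 * ‖u‖) := by
    refine ge_of_tendsto hlim ?_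
    filter_upwards [Ioo_mem_nhdsLT (zero_lt_one (α := ℝ))] with t ht
    exact key t ht.1.le ht.2
  nlinarith

/-- Taking the closure of a graph does not change the adjoint. -/
theorem Submodule.adjoint_topologicalClosure (g : Submodule ℂ (H × H)) :
    g.topologicalClosure.adjoint = g.adjoint := by
  ext p
  simp only [Submodule.mem_adjoint_iff]
  refine ⟨fun h a b hab => h a b (g.le_topologicalClosure hab), fun h a b hab => ?_⟩
  have hc : IsClosed {q : H × H | inner ℂ q.2 p.1 - inner ℂ q.1 p.2 = 0} :=
    isClosed_eq (by fun_prop) continuous_const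
  exact closure_minimal (fun q hq => h q.1 q.2 hq) hc hab

variable [CompleteSpace H]

/-- The basic criterion: a densely defined symmetric operator is essentially self-adjoint when
the ranges of `T ± iμ` are dense. -/
theorem LinearPMap.isClosable_and_adjoint_closure_eq {T : H →ₗ.[ℂ] H}
    (hd : Dense (T.domain : Set H)) (hs : T.IsFormalAdjoint T) {μ : ℝ} (hμ : μ ≠ 0)
    (hr : ∀ ν : ℝ, |ν| = |μ| → DenseRange (T.toFun + (ν * Complex.I) • T.domain.subtype)) :
    T.IsClosable ∧ T.closure† = T.closure := by
  have hle : T ≤ T† := LinearPMap.IsFormalAdjoint.le_adjoint hd hs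
  have hcl : T.IsClosable :=
    LinearPMap.isClosable_iff_exists_closed_extension.2 ⟨T†, LinearPMap.adjoint_isClosed hd, hle⟩
  refine ⟨hcl, ?_⟩
  have hd' : Dense (T.closure.domain : Set H) := hd.mono T.le_closure.1
  have hadj : T.closure†.graph = T†.graph := by
    rw [LinearPMap.adjoint_graph_eq_graph_adjoint hd', LinearPMap.adjoint_graph_eq_graph_adjoint hd,
      ← hcl.graph_closure_eq_closure_graph, Submodule.adjoint_topologicalClosure]
  have hcle : T.closure.graph ≤ T†.graph := by
    rw [← hcl.graph_closure_eq_closure_graph]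
    exact Submodule.topologicalClosure_minimal _ (LinearPMap.le_graph_of_le hle)
      (LinearPMap.adjoint_isClosed hd)
  refine LinearPMap.eq_of_eq_graph (hadj.trans (le_antisymm ?_ hcle))
  set G := T.closure.graph with hG
  have hsymG : ∀ p ∈ G, inner ℂ p.2 p.1 = inner ℂ p.1 p.2 := fun p hp => by
    have h1 : p ∈ G.adjoint := by
      rw [← LinearPMap.adjoint_graph_eq_graph_adjoint hd', hadj]
      exact hcle hp
    exact sub_eq_zero.1 ((Submodule.mem_adjoint_iff _ _).1 h1 p.1 p.2 hp)
  set R : G →L[ℂ] H := (ContinuousLinearMap.snd ℂ H H + (μ * Complex.I) •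
    ContinuousLinearMap.fst ℂ H H).comp G.subtypeL with hR
  have hRv : ∀ p : G, R p = p.1.2 + (μ * Complex.I) • p.1.1 := fun p => rfl
  have hμ' : 0 < |μ| := abs_pos.2 hμ
  -- On the closed graph `G` of the closure, `(x, y) ↦ y + iμx` is bounded below, so its range is
  -- closed; being also dense, it is everything.
  have hanti : AntilipschitzWith (⟨max 1 |μ|⁻¹, by positivity⟩ : NNReal) R := by
    refine R.antilipschitz_of_bound fun p => ?_
    have hp := hsymG p.1 p.2
    have h1 := norm_mul_le_norm_add_I_smul hp μ
    have h2 := norm_le_norm_add_I_smul hp μ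
    rw [hRv]
    change max ‖p.1.1‖ ‖p.1.2‖ ≤ max 1 |μ|⁻¹ * _
    refine max_le ?_ ?_
    · calc ‖p.1.1‖ = |μ|⁻¹ * (|μ| * ‖p.1.1‖) := by field_simp
        _ ≤ _ := by gcongr; exact le_max_right _ _
    · calc ‖p.1.2‖ = 1 * ‖p.1.2‖ := (one_mul _).symm
        _ ≤ _ := by gcongr; exact le_max_left _ _
  have hGc : _root_.IsClosed (G : Set (H × H)) := hcl.closure_isClosed
  have : CompleteSpace G := hGc.completeSpace_coe
  have hran : _root_.IsClosed (range R) := hanti.isClosed_range R.uniformContinuous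
  have hsurj : range R = univ := by
    refine (hran.closure_eq.symm.trans ?_)
    refine Dense.closure_eq ((hr μ rfl).mono ?_)
    rintro _ ⟨x, rfl⟩
    have hx : ((x : H), T x) ∈ G := LinearPMap.le_graph_of_le T.le_closure (T.mem_graph x)
    exact ⟨⟨_, hx⟩, rfl⟩
  intro p hp
  -- A point `p` of the adjoint graph is compared with the point `q` of `G` having the same image.
  -- The first component of the difference is orthogonal to the range of `T - iμ`, which is dense.
  obtain ⟨q, hq⟩ : p.2 + (μ * Complex.I) • p.1 ∈ range R := hsurj ▸ mem_univ _
  have hdiff : p - q.1 ∈ T†.graph := Submodule.sub_mem _ hp (hcle q.2)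
  rw [LinearPMap.adjoint_graph_eq_graph_adjoint hd] at hdiff
  have hsec : p.2 - q.1.2 = -(μ * Complex.I) • (p.1 - q.1.1) := by
    rw [hRv] at hq
    rw [neg_smul, smul_sub, eq_neg_iff_add_eq_zero]
    have := sub_eq_zero.2 hq.symm
    rw [← this]
    abel
  have hfst : p.1 - q.1.1 = 0 := by
    refine Dense.eq_zero_of_inner_right ℂ (hr (-μ) (abs_neg μ)) ?_
    rintro _ ⟨x, rfl⟩
    have h1 := (Submodule.mem_adjoint_iff _ _).1 hdiff x (T x) (T.mem_graph x)
    simp only [Prod.fst_sub, Prod.snd_sub, hsec, inner_smul_right] at h1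
    simp only [LinearMap.add_apply, LinearMap.smul_apply, Submodule.subtype_apply, inner_add_left,
      inner_smul_left, map_mul, Complex.conj_ofReal, Complex.conj_I]
    rw [Complex.ofReal_neg]
    change inner ℂ (T x) _ + _ = 0
    linear_combination h1
  have hsnd : p.2 - q.1.2 = 0 := by rw [hsec, hfst, smul_zero]
  have : p = q.1 := Prod.ext (sub_eq_zero.1 hfst) (sub_eq_zero.1 hsnd)
  rw [this]
  exact q.2

end HilbertSpace

/-! ### From a derivative along the real axis to vertical limits in the half plane. -/

section BoundaryDerivative

/-- The Cayley type map from the first quadrant onto the lower half disc of radius `δ`. -/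
def quadrantToDisc (δ : ℝ) (q : ℂ) : ℂ := -δ * ((q - 1) / (q + 1))

theorem quadrantToDisc_add_one_ne {q : ℂ} (h : 0 ≤ q.re) : q + 1 ≠ 0 := fun h0 => by
  have := congrArg Complex.re h0
  simp at this
  linarith

theorem normSq_sub_one_eq (q : ℂ) :
    Complex.normSq (q - 1) = Complex.normSq (q + 1) - 4 * q.re := by
  simp only [Complex.normSq_apply, Complex.sub_re, Complex.sub_im, Complex.add_re, Complex.add_im,
    Complex.one_re, Complex.one_im]
  ring

/-- Read for its sign: `q` above the real axis lands below it, and real `q` lands on the diameter.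
-/
theorem quadrantToDisc_im (δ : ℝ) (q : ℂ) :
    (quadrantToDisc δ q).im = -(2 * δ * q.im / Complex.normSq (q + 1)) := by
  rw [quadrantToDisc, ← Complex.ofReal_neg, Complex.im_ofReal_mul, Complex.div_im]
  simp only [Complex.sub_re, Complex.sub_im, Complex.add_re, Complex.add_im,
    Complex.one_re, Complex.one_im]
  ring

theorem norm_quadrantToDisc_lt {δ : ℝ} (hδ : 0 < δ) {q : ℂ} (h : 0 < q.re) :
    ‖quadrantToDisc δ q‖ < δ := by
  have h1 := quadrantToDisc_add_one_ne h.le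
  have h2 : ‖q - 1‖ < ‖q + 1‖ := by
    refine abs_lt_of_sq_lt_sq' ?_ (norm_nonneg _) |>.2
    rw [← Complex.normSq_eq_norm_sq, ← Complex.normSq_eq_norm_sq, normSq_sub_one_eq]
    linarith
  rw [quadrantToDisc, norm_mul, norm_neg, Complex.norm_real, Real.norm_of_nonneg hδ.le, norm_div]
  have h3 : ‖q - 1‖ / ‖q + 1‖ < 1 := (div_lt_one (norm_pos_iff.2 h1)).2 h2
  nlinarith

/-- After scaling by `δ`, the Cayley map `z ↦ (1 - z)/(1 + z)` is an involution. -/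
theorem quadrantToDisc_inv {δ : ℝ} (hδ : 0 < δ) {z : ℂ} (hz : ‖z‖ < δ) :
    quadrantToDisc δ ((δ - z) / (δ + z)) = z := by
  have h1 : (δ : ℂ) + z ≠ 0 := fun h0 => by
    have : z = -δ := by linear_combination h0
    rw [this, norm_neg, Complex.norm_real, Real.norm_of_nonneg hδ.le] at hz
    exact lt_irrefl _ hz
  have h2 : (δ : ℂ) ≠ 0 := by exact_mod_cast hδ.ne'
  rw [quadrantToDisc]
  have h3 : (δ - z) / (δ + z) + 1 = 2 * δ / (δ + z) := by field_simp; ring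
  have h4 : (δ - z) / (δ + z) - 1 = -2 * z / (δ + z) := by field_simp; ring
  rw [h3, h4]
  field_simp

/-- Two constants estimate in a half disc, for functions vanishing to first order at the
centre. -/
theorem norm_le_rpow_of_halfDisc {G : ℂ → ℂ} {δ ε K : ℝ} (hδ : 0 < δ) (hε : 0 < ε)
    (hG : Continuous G) (hd : DifferentiableOn ℂ G {z | z.im < 0 ∧ ‖z‖ < δ})
    (hK0 : 0 < K) (hK : ∀ z, ‖G z‖ ≤ K * ‖z‖) (hb : ∀ x : ℝ, |x| < δ → ‖G x‖ ≤ ε * |x|)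
    {z : ℂ} (hz : z.im < 0) (hzδ : ‖z‖ < δ) :
    ‖G z‖ ≤ ε ^ (1 - ((δ - z) / (δ + z)).arg / (Real.pi / 2)) *
      K ^ (((δ - z) / (δ + z)).arg / (Real.pi / 2)) * ‖z‖ := by
  set q : ℂ := (δ - z) / (δ + z) with hq
  have hpi : 0 < Real.pi / 2 := by positivity
  have hden : (δ : ℂ) + z ≠ 0 := fun h0 => by
    have := congrArg Complex.im h0
    simp at this
    exact hz.ne this
  have hns : 0 < Complex.normSq (δ + z) := Complex.normSq_pos.2 hden
  have hqre : 0 < q.re := by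
    have h1 : q.re = (δ ^ 2 - ‖z‖ ^ 2) / Complex.normSq (δ + z) := by
      rw [hq, Complex.div_re, ← Complex.normSq_eq_norm_sq, Complex.normSq_apply z]
      simp only [Complex.sub_re, Complex.sub_im, Complex.add_re, Complex.add_im,
        Complex.ofReal_re, Complex.ofReal_im]
      ring
    rw [h1]
    refine div_pos ?_ hns
    nlinarith [norm_nonneg z]
  have hqim : 0 < q.im := by
    have h1 : q.im = (2 * δ * -z.im) / Complex.normSq (δ + z) := by
      rw [hq, Complex.div_im]
      simp only [Complex.sub_re, Complex.sub_im, Complex.add_re, Complex.add_im,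
        Complex.ofReal_re, Complex.ofReal_im]
      ring
    rw [h1]
    exact div_pos (by nlinarith) hns
  have hq0 : q ≠ 0 := fun h => by simp [h] at hqre
  -- In the coordinate `ζ` the half disc becomes the vertical strip `0 < Re < π/2`: the diameter is
  -- the line `Re = 0`, the semicircle the line `Re = π/2`. So `q.arg / (π/2)` is the harmonic
  -- measure of the semicircle, and the three lines theorem applies.
  set ζ : ℂ := -Complex.I * Complex.log q with hζ
  have hζre : ζ.re = q.arg := by simp [hζ, Complex.log_im]
  have hζq : Complex.exp (Complex.I * ζ) = q := by
    rw [hζ, ← mul_assoc, mul_neg, Complex.I_mul_I, neg_neg, one_mul, Complex.exp_log hq0]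
  have harg0 : 0 ≤ q.arg := Complex.arg_nonneg_iff.2 hqim.le
  have harg1 : q.arg ≤ Real.pi / 2 :=
    (abs_le.1 (Complex.abs_arg_le_pi_div_two_iff.2 hqre.le)).2
  -- the transported function
  set p : ℂ → ℂ := fun w => quadrantToDisc δ (Complex.exp (Complex.I * w)) with hp
  have hre : ∀ w : ℂ, (Complex.exp (Complex.I * w)).re = Real.exp (-w.im) * Real.cos w.re := by
    intro w
    rw [Complex.exp_re]
    simp
  have him : ∀ w : ℂ, (Complex.exp (Complex.I * w)).im = Real.exp (-w.im) * Real.sin w.re := by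
    intro w
    rw [Complex.exp_im]
    simp
  have hclosed : ∀ w : ℂ, w.re ∈ Icc 0 (Real.pi / 2) →
      0 ≤ (Complex.exp (Complex.I * w)).re ∧ 0 ≤ (Complex.exp (Complex.I * w)).im := by
    intro w hw
    rw [hre, him]
    exact ⟨mul_nonneg (Real.exp_pos _).le (Real.cos_nonneg_of_mem_Icc ⟨by linarith [hw.1], hw.2⟩),
      mul_nonneg (Real.exp_pos _).le (Real.sin_nonneg_of_mem_Icc ⟨hw.1, by linarith [hw.2]⟩)⟩
  have hopen : ∀ w : ℂ, w.re ∈ Ioo 0 (Real.pi / 2) →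
      0 < (Complex.exp (Complex.I * w)).re ∧ 0 < (Complex.exp (Complex.I * w)).im := by
    intro w hw
    rw [hre, him]
    exact ⟨mul_pos (Real.exp_pos _) (Real.cos_pos_of_mem_Ioo ⟨by linarith [hw.1], hw.2⟩),
      mul_pos (Real.exp_pos _) (Real.sin_pos_of_mem_Ioo ⟨hw.1, by linarith [hw.2]⟩)⟩
  have hpim : ∀ w : ℂ, w.re ∈ Icc 0 (Real.pi / 2) → (p w).im ≤ 0 := by
    intro w hw
    rw [hp]
    simp only [quadrantToDisc_im]
    have := (hclosed w hw).2
    rw [neg_nonpos]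
    have := Complex.normSq_nonneg (Complex.exp (Complex.I * w) + 1)
    positivity
  have hpd : ∀ w : ℂ, w.re ∈ Icc 0 (Real.pi / 2) → DifferentiableAt ℂ p w := by
    intro w hw
    have h1 := quadrantToDisc_add_one_ne (hclosed w hw).1
    simp only [hp, quadrantToDisc]
    fun_prop (disch := exact h1)
  -- The estimate is for `G z / z`, whose denominator vanishes on the boundary. Moving the zero to
  -- `κi`, above the axis, keeps the quotient regular and only enlarges the denominator; `κ` tends
  -- to `0` at the end.
  have hκ : ∀ κ : ℝ, 0 < κ → ∀ v : ℂ, v.im ≤ 0 → ‖v‖ ≤ ‖v - κ * Complex.I‖ ∧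
      v - κ * Complex.I ≠ 0 := by
    intro κ hκ v hv
    refine ⟨?_, fun h => ?_⟩
    · refine abs_le_of_sq_le_sq' ?_ (norm_nonneg _) |>.2
      rw [← Complex.normSq_eq_norm_sq, ← Complex.normSq_eq_norm_sq, Complex.normSq_apply,
        Complex.normSq_apply]
      simp
      nlinarith
    · have := congrArg Complex.im h
      simp at this
      linarith
  have hquot : ∀ κ : ℝ, 0 < κ → ∀ v : ℂ, v.im ≤ 0 → ∀ c : ℝ, ‖G v‖ ≤ c * ‖v‖ → 0 ≤ c →
      ‖G v / (v - κ * Complex.I)‖ ≤ c := by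
    intro κ h1 v hv c h2 hc
    obtain ⟨h3, h4⟩ := hκ κ h1 v hv
    rw [norm_div, div_le_iff₀ (norm_pos_iff.2 h4)]
    exact h2.trans (by gcongr)
  have hthree : ∀ κ : ℝ, 0 < κ → ‖G z‖ ≤ ε ^ (1 - q.arg / (Real.pi / 2)) *
      K ^ (q.arg / (Real.pi / 2)) * ‖z - κ * Complex.I‖ := by
    intro κ hκ0
    have hmain := Complex.HadamardThreeLines.norm_le_interp_of_mem_verticalClosedStrip'
      (f := fun w => G (p w) / (p w - κ * Complex.I)) (z := ζ) (a := ε) (b := K) hpi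
      (by
        change ζ.re ∈ Icc _ _
        rw [hζre]
        exact ⟨harg0, harg1⟩)
      (by
        refine ⟨?_, ?_⟩
        · intro w hw
          have hw' : w.re ∈ Icc 0 (Real.pi / 2) := Ioo_subset_Icc_self hw
          have hpw := (hpd w hw').differentiableWithinAt
            (s := Complex.HadamardThreeLines.verticalStrip 0 (Real.pi / 2))
          have hnn : 0 < Complex.normSq (Complex.exp (Complex.I * w) + 1) :=
            Complex.normSq_pos.2 (quadrantToDisc_add_one_ne (hclosed w hw').1)
          have hmem : p w ∈ {z : ℂ | z.im < 0 ∧ ‖z‖ < δ} := by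
            refine ⟨?_, norm_quadrantToDisc_lt hδ (hopen w hw).1⟩
            simp only [hp, quadrantToDisc_im, neg_lt_zero]
            have := (hopen w hw).2
            positivity
          have hop : IsOpen {z : ℂ | z.im < 0 ∧ ‖z‖ < δ} :=
            (isOpen_lt Complex.continuous_im continuous_const).inter
              (isOpen_lt continuous_norm continuous_const)
          refine DifferentiableWithinAt.div ?_ (hpw.sub_const _) (hκ κ hκ0 _ (hpim w hw')).2
          exact ((hd.differentiableAt (hop.mem_nhds hmem)).comp w
            (hpd w hw')).differentiableWithinAt
        · have hcl : closure (Complex.HadamardThreeLines.verticalStrip 0 (Real.pi / 2)) ⊆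
              Complex.re ⁻¹' Icc 0 (Real.pi / 2) :=
            closure_minimal (preimage_mono Ioo_subset_Icc_self)
              (isClosed_Icc.preimage Complex.continuous_re)
          refine ContinuousOn.mono ?_ hcl
          intro w hw
          have hpw := (hpd w hw).continuousAt
          exact (ContinuousAt.div (hG.continuousAt.comp hpw) (hpw.sub continuousAt_const)
            (hκ κ hκ0 _ (hpim w hw)).2).continuousWithinAt)
      (by
        refine ⟨K, ?_⟩
        rintro _ ⟨w, hw, rfl⟩
        exact hquot κ hκ0 _ (hpim w hw) K (hK _) hK0.le)
      (by
        intro w hw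
        have hw0 : w.re = 0 := hw
        have hw' : w.re ∈ Icc 0 (Real.pi / 2) := by rw [hw0]; exact ⟨le_rfl, hpi.le⟩
        refine hquot κ hκ0 _ (hpim w hw') ε ?_ hε.le
        have hi : (p w).im = 0 := by
          simp only [hp, quadrantToDisc_im, him, hw0, Real.sin_zero, mul_zero, zero_div, neg_zero]
        have hr : (((p w).re : ℝ) : ℂ) = p w := Complex.ext (by simp) (by simp [hi])
        have hlt : ‖p w‖ < δ := norm_quadrantToDisc_lt hδ (by
          rw [hre, hw0, Real.cos_zero, mul_one]; exact Real.exp_pos _)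
        rw [← hr, Complex.norm_real] at hlt ⊢
        exact hb _ hlt)
      (by
        intro w hw
        have hw0 : w.re = Real.pi / 2 := hw
        have hw' : w.re ∈ Icc 0 (Real.pi / 2) := by rw [hw0]; exact ⟨hpi.le, le_rfl⟩
        exact hquot κ hκ0 _ (hpim w hw') K (hK _) hK0.le)
    have hpζ : p ζ = z := by
      simp only [hp, hζq]
      exact quadrantToDisc_inv hδ hzδ
    simp only [hpζ, hζre, sub_zero] at hmain
    rwa [norm_div, div_le_iff₀ (norm_pos_iff.2 (hκ κ hκ0 z hz.le).2)] at hmain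
  have hlim : Tendsto (fun κ : ℝ => ε ^ (1 - q.arg / (Real.pi / 2)) *
      K ^ (q.arg / (Real.pi / 2)) * ‖z - κ * Complex.I‖) (𝓝[>] 0)
      (𝓝 (ε ^ (1 - q.arg / (Real.pi / 2)) * K ^ (q.arg / (Real.pi / 2)) * ‖z‖)) := by
    refine tendsto_nhdsWithin_of_tendsto_nhds ?_
    have : Continuous (fun κ : ℝ => ε ^ (1 - q.arg / (Real.pi / 2)) *
      K ^ (q.arg / (Real.pi / 2)) * ‖z - κ * Complex.I‖) := by fun_prop
    simpa using this.tendsto 0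
  exact ge_of_tendsto hlim (by filter_upwards [self_mem_nhdsWithin] with κ hκ using hthree κ hκ)

/-- If a Lipschitz function, analytic in a lower half disc, is `o(|x|)` on the real axis, then
it is `o(|z|)` in the lower half plane. -/
theorem exists_norm_le_mul_norm_of_real {G : ℂ → ℂ} {δ K : ℝ} (hδ : 0 < δ)
    (hG : Continuous G) (hd : DifferentiableOn ℂ G {z | z.im < 0 ∧ ‖z‖ < δ})
    (hK0 : 0 < K) (hK : ∀ z, ‖G z‖ ≤ K * ‖z‖)
    (hb : ∀ ε > 0, ∀ᶠ x : ℝ in 𝓝 0, ‖G x‖ ≤ ε * |x|) {ε : ℝ} (hε : 0 < ε) :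
    ∃ ρ > 0, ∀ z : ℂ, z.im < 0 → ‖z‖ < ρ → ‖G z‖ ≤ ε * ‖z‖ := by
  obtain ⟨δ₁, hδ₁, h1⟩ := Metric.eventually_nhds_iff.1 (hb (ε / 2) (by positivity))
  set d := min δ δ₁ with hd'
  have hd0 : 0 < d := lt_min hδ hδ₁
  have hdC : (d : ℂ) ≠ 0 := by exact_mod_cast hd0.ne'
  set t : ℂ → ℝ := fun z => ((d - z) / (d + z)).arg / (Real.pi / 2) with ht
  have htc : ContinuousAt t 0 := by
    have h2 : ContinuousAt (fun z : ℂ => (d - z) / (d + z)) 0 :=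
      ContinuousAt.div (by fun_prop) (by fun_prop) (by simpa using hdC)
    have h3 : ((d : ℂ) - 0) / (d + 0) ∈ Complex.slitPlane := by
      simp [hdC]
    exact (ContinuousAt.comp (f := fun z : ℂ => ((d : ℂ) - z) / (d + z))
      (Complex.continuousAt_arg h3) h2).div_const _
  have ht0 : t 0 = 0 := by simp [ht, hdC]
  -- The harmonic measure `t` vanishes at the centre of the diameter, so the interpolated constant
  -- tends to `ε / 2` whatever `K` is. Starting from `ε / 2` on the real axis leaves the room
  -- needed.
  have hlim : Tendsto (fun z => (ε / 2) ^ (1 - t z) * K ^ (t z)) (𝓝 0) (𝓝 (ε / 2)) := by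
    have h2 : Tendsto t (𝓝 0) (𝓝 0) := by simpa [ht0] using htc.tendsto
    have h3 := ((tendsto_const_nhds (x := ε / 2)).rpow ((tendsto_const_nhds (x := (1 : ℝ))).sub h2)
      (Or.inl (by positivity))).mul
      ((tendsto_const_nhds (x := K)).rpow h2 (Or.inl hK0.ne'))
    simpa using h3
  obtain ⟨ρ, hρ, h2⟩ := Metric.eventually_nhds_iff.1 (hlim.eventually_lt_const (half_lt_self hε))
  refine ⟨min ρ d, lt_min hρ hd0, fun z hz hzρ => ?_⟩
  have h3 := norm_le_rpow_of_halfDisc hd0 (half_pos hε) hG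
    (hd.mono fun w hw => ⟨hw.1, hw.2.trans_le (min_le_left _ _)⟩) hK0 hK
    (fun x hx => h1 (by simpa using hx.trans_le (min_le_right _ _))) hz
    (hzρ.trans_le (min_le_right _ _))
  refine h3.trans ?_
  gcongr
  exact (h2 (y := z) (by simpa using hzρ.trans_le (min_le_left _ _))).le

/-- If the real boundary function of `F` is differentiable at `0`, then the derivative of `F`
converges vertically. -/
theorem tendsto_deriv_of_hasDerivAt_real {F f : ℂ → ℂ} {δ K : ℝ} (hδ : 0 < δ)
    (hF : ∀ z w, ‖F z - F w‖ ≤ K * ‖z - w‖)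
    (hd : ∀ z : ℂ, z.im < 0 → ‖z‖ < δ → HasDerivAt F (f z) z) {c : ℂ}
    (hc : HasDerivAt (fun x : ℝ => F x) c 0) :
    Tendsto (fun y : ℝ => f (y * Complex.I)) (𝓝[<] 0) (𝓝 c) := by
  have hK : 0 ≤ K := by
    have h1 := (norm_nonneg _).trans (hF 1 0)
    simpa using h1
  have hFc : Continuous F :=
    (LipschitzWith.of_dist_le_mul (K := ⟨K, hK⟩) fun z w => by
      rw [dist_eq_norm, dist_eq_norm]; exact hF z w).continuous
  set G : ℂ → ℂ := fun z => F z - F 0 - c * z with hG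
  have hGd : ∀ z : ℂ, z.im < 0 → ‖z‖ < δ → HasDerivAt G (f z - c) z := fun z hz hzδ => by
    have h1 := ((hd z hz hzδ).sub_const (F 0)).sub ((hasDerivAt_id z).const_mul c)
    rw [mul_one] at h1
    exact h1
  have hGK : ∀ z, ‖G z‖ ≤ (K + ‖c‖ + 1) * ‖z‖ := fun z => by
    have h1 := hF z 0
    rw [sub_zero] at h1
    calc ‖G z‖ ≤ ‖F z - F 0‖ + ‖c * z‖ := norm_sub_le _ _
      _ ≤ K * ‖z‖ + ‖c‖ * ‖z‖ := by rw [norm_mul]; gcongr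
      _ ≤ _ := by nlinarith [norm_nonneg z]
  have hGb : ∀ ε > 0, ∀ᶠ x : ℝ in 𝓝 0, ‖G x‖ ≤ ε * |x| := fun ε hε => by
    have h1 := (hasDerivAt_iff_isLittleO.1 hc).def hε
    filter_upwards [h1] with x hx
    simpa [hG, mul_comm] using hx
  rw [Metric.tendsto_nhds]
  intro ε hε
  obtain ⟨ρ, hρ, h1⟩ := exists_norm_le_mul_norm_of_real hδ (by simp only [hG]; fun_prop)
    (fun z hz => (hGd z hz.1 hz.2).differentiableAt.differentiableWithinAt)
    (by positivity) hGK hGb (ε := ε / 4) (by positivity)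
  have hm : -(min ρ δ / 2) < (0 : ℝ) := by
    have := lt_min hρ hδ
    linarith
  filter_upwards [Ioo_mem_nhdsLT hm] with y hy
  have hy0 : 0 < -y := by linarith [hy.2]
  have hyρ : -y * 2 < ρ := by
    have := min_le_left ρ δ
    linarith [hy.1]
  have hyδ : -y * 2 < δ := by
    have := min_le_right ρ δ
    linarith [hy.1]
  have hsub : ∀ z ∈ Metric.closedBall (y * Complex.I) (-y / 2), z.im < 0 ∧ ‖z‖ ≤ -y * 2 := by
    intro z hz
    rw [mem_closedBall_iff_norm] at hz
    refine ⟨?_, ?_⟩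
    · have h2 := (Complex.abs_im_le_norm _).trans hz
      have h3 := (abs_le.1 h2).2
      simp at h3
      linarith
    · have h2 := norm_le_norm_add_norm_sub' z (y * Complex.I)
      have h3 : ‖(y * Complex.I : ℂ)‖ = -y := by
        simp [abs_of_neg hy.2]
      linarith
  have hmemc : (y * Complex.I : ℂ) ∈ Metric.closedBall (y * Complex.I : ℂ) (-y / 2) :=
    Metric.mem_closedBall_self (by linarith)
  -- Cauchy's estimate on the circle of radius `|y|/2` about `iy`, where `‖z‖ ≤ 3|y|/2`: the factors
  -- `|y|` cancel and leave `3ε/4`.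
  have h2 := Complex.norm_deriv_le_of_forall_mem_sphere_norm_le (f := G) (c := y * Complex.I)
    (R := -y / 2) (C := ε / 4 * (-y * 3 / 2)) (by linarith)
    (DifferentiableOn.diffContOnCl (by
      rw [closure_ball _ (by linarith)]
      intro z hz
      obtain ⟨h3, h4⟩ := hsub z hz
      exact (hGd z h3 (h4.trans_lt hyδ)).differentiableAt.differentiableWithinAt))
    (fun z hz => by
      obtain ⟨h3, h4⟩ := hsub z (Metric.sphere_subset_closedBall hz)
      refine (h1 z h3 (h4.trans_lt hyρ)).trans ?_
      gcongr
      have h2 := norm_le_norm_add_norm_sub' z (y * Complex.I)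
      rw [mem_sphere_iff_norm] at hz
      have h3 : ‖(y * Complex.I : ℂ)‖ = -y := by
        simp [abs_of_neg hy.2]
      linarith)
  obtain ⟨h3, h4⟩ := hsub _ hmemc
  rw [(hGd _ h3 (h4.trans_lt hyδ)).deriv] at h2
  rw [dist_eq_norm]
  refine h2.trans_lt ?_
  have : ε / 4 * (-y * 3 / 2) / (-y / 2) = 3 / 4 * ε := by
    have := hy.2.ne
    field_simp
  rw [this]
  linarith

end BoundaryDerivative

/-! ### Fatou's theorem on the strip and dominated convergence of slices. -/

namespace BoundState

theorem convex_strip (a b : ℝ) : Convex ℝ (strip a b) :=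
  ((convex_Ioo a b).is_linear_preimage (f := Complex.im) Complex.imLm.isLinear :)

/-- Fatou's theorem on the strip, at the upper boundary. -/
theorem IsHardyInfty.ae_tendsto_upper {a : ℝ} (ha : a < 0) {f : ℂ → ℂ} (hf : IsHardyInfty a 0 f) :
    ∀ᵐ θ : ℝ, ∃ c, Tendsto (fun y => slice f y θ) (𝓝[<] 0) (𝓝 c) := by
  obtain ⟨C, hC⟩ := hf.bounded
  have ho := isOpen_strip a 0
  -- A bounded `f` has a Lipschitz primitive on the convex strip. Extended to a Lipschitz map on
  -- `ℂ`, it is differentiable along `ℝ` almost everywhere, and at such points `f` has a vertical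
  -- limit.
  obtain ⟨g, hg⟩ := (convex_strip a 0).exists_forall_hasDerivWithinAt hf.analytic
  have hC0 : 0 ≤ C := (norm_nonneg _).trans (hC (a / 2 * Complex.I) (by
    constructor <;> simp <;> linarith))
  lift C to NNReal using hC0
  have hlip : LipschitzOnWith C g (strip a 0) :=
    (convex_strip a 0).lipschitzOnWith_of_nnnorm_hasDerivWithin_le hg fun z hz => hC z hz
  obtain ⟨F, hF, hFg⟩ := hlip.extend_finite_dimension
  have hFd : ∀ z ∈ strip a 0, HasDerivAt F (f z) z := fun z hz =>
    ((hg z hz).hasDerivAt (ho.mem_nhds hz)).congr_of_eventuallyEq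
      (hFg.symm.eventuallyEq_of_mem (ho.mem_nhds hz))
  set K := lipschitzExtensionConstant ℂ * C with hK
  have hFr : LipschitzWith K fun x : ℝ => F x := by
    have := hF.comp Complex.isometry_ofReal.lipschitz
    rwa [mul_one] at this
  filter_upwards [hFr.ae_differentiableAt_real] with θ hθ
  refine ⟨deriv (fun x : ℝ => F x) θ, ?_⟩
  have h1 := tendsto_deriv_of_hasDerivAt_real (F := fun z => F (θ + z)) (f := fun z => f (θ + z))
    (δ := -a) (K := K) (by linarith)
    (fun z w => by
      have := hF.dist_le_mul (θ + z) (θ + w)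
      simpa [dist_eq_norm] using this)
    (fun z hz hza => by
      have hm : (θ : ℂ) + z ∈ strip a 0 := by
        have := (abs_lt.1 ((Complex.abs_im_le_norm z).trans_lt hza)).1
        constructor <;> simp <;> linarith
      exact (hFd _ hm).comp_const_add (θ : ℂ) z)
    (c := deriv (fun x : ℝ => F x) θ)
    (by
      have h2 : HasDerivAt (fun x : ℝ => F x) (deriv (fun x : ℝ => F x) θ) (θ + 0) := by
        rw [add_zero]; exact hθ.hasDerivAt
      have := h2.comp_const_add θ 0
      simpa using this)
  exact h1

/-- Dominated convergence in `L²`. -/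
theorem tendsto_eLpNorm_two_zero_of_dominated {ι : Type*} {l : Filter ι} [l.IsCountablyGenerated]
    {F : ι → ℝ → ℂ} {H : ℝ → ℝ} (hF : ∀ᶠ i in l, AEStronglyMeasurable (F i) volume)
    (hH : MemLp H 2 volume) (hb : ∀ᶠ i in l, ∀ᵐ θ, ‖F i θ‖ ≤ H θ)
    (hl : ∀ᵐ θ, Tendsto (fun i => F i θ) l (𝓝 0)) :
    Tendsto (fun i => eLpNorm (F i) 2 volume) l (𝓝 0) := by
  have h1 : Tendsto (fun i => ∫⁻ θ, ‖F i θ‖ₑ ^ (2 : ℝ)) l (𝓝 (∫⁻ _ : ℝ, 0)) := by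
    refine tendsto_lintegral_filter_of_dominated_convergence' (fun θ => ‖H θ‖ₑ ^ (2 : ℝ)) ?_ ?_ ?_ ?_
    · filter_upwards [hF] with i hi using hi.enorm.pow_const _
    · filter_upwards [hb] with i hi
      filter_upwards [hi] with θ hθ
      gcongr
      rw [← ofReal_norm, ← ofReal_norm]
      exact ENNReal.ofReal_le_ofReal (hθ.trans (le_abs_self _))
    · exact (lintegral_rpow_enorm_lt_top_of_eLpNorm_lt_top two_ne_zero ENNReal.ofNat_ne_top
        hH.2).ne
    · filter_upwards [hl] with θ hθ
      have h2 := (ENNReal.continuous_rpow_const (y := (2 : ℝ))).tendsto 0 |>.comp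
        (by simpa using hθ.enorm : Tendsto (fun i => ‖F i θ‖ₑ) l (𝓝 0))
      rw [ENNReal.zero_rpow_of_pos two_pos] at h2
      exact h2
  have h3 := (ENNReal.continuous_rpow_const (y := (1 / 2 : ℝ))).tendsto _ |>.comp h1
  simp only [lintegral_zero, one_div, inv_pos, Nat.ofNat_pos, ENNReal.zero_rpow_of_pos] at h3
  refine h3.congr fun i => ?_
  rw [eLpNorm_eq_lintegral_rpow_enorm_toReal two_ne_zero ENNReal.ofNat_ne_top]
  simp

theorem sliceTendsto_of_dominated {ξ : ℂ → ℂ} {l : Filter ℝ} [l.IsCountablyGenerated] {u : L2}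
    {H : ℝ → ℝ} (hξ : ∀ᶠ y in l, AEStronglyMeasurable (slice ξ y) volume) (hH : MemLp H 2 volume)
    (hb : ∀ᶠ y in l, ∀ᵐ θ, ‖slice ξ y θ‖ ≤ H θ)
    (hl : ∀ᵐ θ, Tendsto (fun y => slice ξ y θ) l (𝓝 (u θ))) : SliceTendsto ξ l u := by
  refine tendsto_eLpNorm_two_zero_of_dominated (H := fun θ => H θ + ‖u θ‖) ?_
    (hH.add (Lp.memLp u).norm) ?_ ?_
  · filter_upwards [hξ] with y hy using hy.sub (Lp.aestronglyMeasurable u)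
  · filter_upwards [hb] with y hy
    filter_upwards [hy] with θ hθ
    exact (norm_sub_le _ _).trans (by gcongr)
  · filter_upwards [hl] with θ hθ
    simpa using hθ.sub_const (u θ)

/-! ### Gaussians as explicit elements of the Hardy space. -/

/-- The Gaussian centred at `w`. -/
def gauss (w z : ℂ) : ℂ := Complex.exp (-(z - w) ^ 2)

theorem norm_gauss (w z : ℂ) :
    ‖gauss w z‖ = Real.exp (-(z.re - w.re) ^ 2) * Real.exp ((z.im - w.im) ^ 2) := by
  rw [gauss, Complex.norm_exp, ← Real.exp_add]
  congr 1
  simp [pow_two]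
  ring

theorem differentiable_gauss (w : ℂ) : Differentiable ℂ (gauss w) := by
  unfold gauss
  fun_prop

theorem continuous_slice_gauss (w : ℂ) (y : ℝ) : Continuous (slice (gauss w) y) :=
  (differentiable_gauss w).continuous.comp (by fun_prop)

theorem memLp_exp_neg_sq (a : ℝ) : MemLp (fun θ : ℝ => Real.exp (-(θ - a) ^ 2)) 2 volume := by
  rw [memLp_two_iff_integrable_sq (by fun_prop)]
  refine ((integrable_exp_neg_mul_sq (b := 2) two_pos).comp_sub_right a).congr
    (Eventually.of_forall fun θ => ?_)
  simp only [← Real.exp_nat_mul]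
  congr 1
  push_cast
  ring

theorem norm_slice_gauss_le (w : ℂ) {M y : ℝ} (hM : |y - w.im| ≤ M) (θ : ℝ) :
    ‖slice (gauss w) y θ‖ ≤ Real.exp (M ^ 2) * Real.exp (-(θ - w.re) ^ 2) := by
  rw [slice, norm_gauss, mul_comm]
  have : (y - w.im) ^ 2 ≤ M ^ 2 := sq_le_sq' (abs_le.1 hM).1 (abs_le.1 hM).2
  simp only [Complex.add_re, Complex.ofReal_re, Complex.mul_re, Complex.I_re, mul_zero,
    Complex.ofReal_im, Complex.I_im, mul_one, sub_self, add_zero, Complex.add_im, Complex.mul_im,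
    zero_add]
  gcongr

theorem memLp_slice_gauss (w : ℂ) (y : ℝ) : MemLp (slice (gauss w) y) 2 volume :=
  ((memLp_exp_neg_sq w.re).const_mul (Real.exp (|y - w.im| ^ 2))).mono'
    (continuous_slice_gauss w y).aestronglyMeasurable
    (Eventually.of_forall (norm_slice_gauss_le w le_rfl))

theorem abs_sub_im_le_of_mem {y : ℝ} (hy : y ∈ Ioo (-Real.pi) 0) (w : ℂ) :
    |y - w.im| ≤ Real.pi + |w.im| := by
  refine (abs_sub _ _).trans ?_
  gcongr
  rw [abs_of_neg hy.2]
  linarith [hy.1]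

theorem isHardyTwo_gauss (w : ℂ) : IsHardyTwo (-Real.pi) 0 (gauss w) where
  analytic := (differentiable_gauss w).differentiableOn
  memLp y _ := memLp_slice_gauss w y
  bounded := by
    refine ⟨_, ((memLp_exp_neg_sq w.re).const_mul
      (Real.exp ((Real.pi + |w.im|) ^ 2))).2.ne, fun y hy => ?_⟩
    exact eLpNorm_mono_real (norm_slice_gauss_le w (abs_sub_im_le_of_mem hy w))

/-- The boundary value of a Gaussian on the line `ℝ + iy`. -/
def gaussSlice (w : ℂ) (y : ℝ) : L2 := (memLp_slice_gauss w y).toLp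

theorem sliceTendsto_gauss (w : ℂ) {l : Filter ℝ} [l.IsCountablyGenerated] {y₀ : ℝ}
    (hl : ∀ᶠ y in l, y ∈ Ioo (-Real.pi) 0) (hl' : l ≤ 𝓝 y₀) :
    SliceTendsto (gauss w) l (gaussSlice w y₀) := by
  refine sliceTendsto_of_dominated
    (Eventually.of_forall fun y => (continuous_slice_gauss w y).aestronglyMeasurable)
    ((memLp_exp_neg_sq w.re).const_mul (Real.exp ((Real.pi + |w.im|) ^ 2))) ?_ ?_
  · filter_upwards [hl] with y hy
    exact Eventually.of_forall (norm_slice_gauss_le w (abs_sub_im_le_of_mem hy w))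
  · filter_upwards [(memLp_slice_gauss w y₀).coeFn_toLp] with θ hθ
    rw [gaussSlice, hθ]
    have hc : Continuous fun y => slice (gauss w) y θ :=
      (differentiable_gauss w).continuous.comp (by fun_prop)
    exact (hc.tendsto y₀).mono_left hl'

theorem isBoundaryPair_gauss (w : ℂ) :
    IsBoundaryPair (gaussSlice w 0) (gaussSlice w (-Real.pi)) :=
  ⟨gauss w, isHardyTwo_gauss w, sliceTendsto_gauss w eventually_top nhdsWithin_le_nhds,
    sliceTendsto_gauss w eventually_bot nhdsWithin_le_nhds⟩

/-! ### The Gaussian transform: analyticity, bounds, injectivity, quasi-periodicity. -/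

/-- The Gaussian transform of `u ∈ L²(ℝ)`, an entire function. -/
def gaussTransform (u : L2) (z : ℂ) : ℂ := ∫ θ : ℝ, gauss z θ * u θ

/-- The conjugate of a Gaussian in `θ` is a Gaussian with conjugate centre. Hence pairing `u` with
the two boundary values of one Gaussian evaluates a single entire function at two points differing
by `πi`. -/
theorem inner_gaussSlice (w : ℂ) (y : ℝ) (u : L2) :
    inner ℂ (gaussSlice w y) u = gaussTransform u (starRingEnd ℂ w + y * Complex.I) := by
  rw [L2.inner_def, gaussTransform]
  refine integral_congr_ae ?_
  filter_upwards [(memLp_slice_gauss w y).coeFn_toLp] with θ hθ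
  rw [gaussSlice, hθ, RCLike.inner_apply', slice, gauss, gauss, ← Complex.exp_conj]
  congr 2
  simp
  ring

/-- From `(a + b)² ≤ 2a² + 2b²`: halving the decay rate buys a majorant independent of the centre
`z` in the ball. -/
theorem norm_gauss_le_of_mem_ball {z₀ z : ℂ} {ρ : ℝ} (hz : ‖z - z₀‖ ≤ ρ) (θ : ℝ) :
    ‖gauss z θ‖ ≤ Real.exp (ρ ^ 2 + (|z₀.im| + ρ) ^ 2) * Real.exp (-(θ - z₀.re) ^ 2 / 2) := by
  rw [norm_gauss, ← Real.exp_add, ← Real.exp_add]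
  refine Real.exp_le_exp.2 ?_
  have h1 := (Complex.abs_re_le_norm _).trans hz
  have h2 := (Complex.abs_im_le_norm _).trans hz
  rw [Complex.sub_re] at h1
  rw [Complex.sub_im] at h2
  simp only [Complex.ofReal_re, Complex.ofReal_im]
  have h3 : (z.re - z₀.re) ^ 2 ≤ ρ ^ 2 := sq_le_sq' (abs_le.1 h1).1 (abs_le.1 h1).2
  have h4 : (0 - z.im) ^ 2 ≤ (|z₀.im| + ρ) ^ 2 := by
    have h5 : |z.im| ≤ |z₀.im| + ρ := by
      have := abs_sub_abs_le_abs_sub z.im z₀.im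
      linarith
    rw [zero_sub, neg_sq]
    exact sq_le_sq' (abs_le.1 h5).1 (abs_le.1 h5).2
  nlinarith [sq_nonneg ((θ - z.re) - (z.re - z₀.re))]

theorem memLp_exp_neg_sq_div_two (a : ℝ) :
    MemLp (fun θ : ℝ => Real.exp (-(θ - a) ^ 2 / 2)) 2 volume := by
  rw [memLp_two_iff_integrable_sq (by fun_prop)]
  refine ((integrable_exp_neg_mul_sq (b := 1) one_pos).comp_sub_right a).congr
    (Eventually.of_forall fun θ => ?_)
  simp only [← Real.exp_nat_mul]
  congr 1
  push_cast
  ring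

theorem hasDerivAt_gauss_left (z : ℂ) (v : ℂ) :
    HasDerivAt (fun z => gauss z v) (2 * (v - z) * gauss z v) z := by
  have h1 : HasDerivAt (fun z : ℂ => -(v - z) ^ 2) (2 * (v - z)) z := by
    have := (((hasDerivAt_id z).const_sub v).pow 2).neg
    simp only [Nat.cast_ofNat, Nat.add_one_sub_one, pow_one, id_eq, mul_neg, mul_one,
      neg_neg] at this
    exact this
  have := h1.cexp
  rw [mul_comm] at this
  exact this

theorem integrable_gauss_mul (u : L2) (z : ℂ) : Integrable (fun θ : ℝ => gauss z θ * u θ) := by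
  have h1 : (fun θ : ℝ => gauss z θ) = slice (gauss z) 0 := by
    ext θ; simp [slice]
  have h2 : MemLp (fun θ : ℝ => gauss z θ) 2 volume := h1 ▸ memLp_slice_gauss z 0
  exact h2.integrable_mul (Lp.memLp u)

theorem differentiable_gaussTransform (u : L2) : Differentiable ℂ (gaussTransform u) := by
  intro z₀
  -- Radius `2` is the unit ball of parameters enlarged by the unit circle used in Cauchy's estimate
  -- for the derivative.
  set C : ℝ := Real.exp (2 ^ 2 + (|z₀.im| + 2) ^ 2)
  have hcont : ∀ z : ℂ, Continuous fun θ : ℝ => gauss z θ := fun z =>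
    (differentiable_gauss z).continuous.comp Complex.continuous_ofReal
  have hbd : ∀ θ : ℝ, ∀ z ∈ Metric.ball z₀ 1,
      ‖2 * (θ - z) * gauss z θ‖ ≤ C * Real.exp (-(θ - z₀.re) ^ 2 / 2) := by
    intro θ z hz
    rw [← (hasDerivAt_gauss_left z θ).deriv]
    have h1 := Complex.norm_deriv_le_of_forall_mem_sphere_norm_le (f := fun z => gauss z θ)
      (c := z) (R := 1) (C := C * Real.exp (-(θ - z₀.re) ^ 2 / 2)) one_pos
      (Differentiable.diffContOnCl fun z => (hasDerivAt_gauss_left z θ).differentiableAt)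
      (fun w hw => norm_gauss_le_of_mem_ball (by
        rw [mem_ball_iff_norm] at hz
        rw [mem_sphere_iff_norm] at hw
        calc ‖w - z₀‖ = ‖(w - z) + (z - z₀)‖ := by ring_nf
          _ ≤ 1 + 1 := (norm_add_le _ _).trans (add_le_add hw.le hz.le)
          _ = 2 := by norm_num) θ)
    simpa using h1
  have key := hasDerivAt_integral_of_dominated_loc_of_deriv_le (𝕜 := ℂ) (μ := volume)
    (F := fun z (θ : ℝ) => gauss z θ * u θ) (F' := fun z (θ : ℝ) => 2 * (θ - z) * gauss z θ * u θ)
    (x₀ := z₀) (s := Metric.ball z₀ 1)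
    (bound := fun θ => C * Real.exp (-(θ - z₀.re) ^ 2 / 2) * ‖u θ‖)
    (Metric.ball_mem_nhds z₀ one_pos)
    (Eventually.of_forall fun z => (integrable_gauss_mul u z).1)
    (integrable_gauss_mul u z₀)
    (((by fun_prop : Continuous fun θ : ℝ => 2 * ((θ : ℂ) - z₀)).mul
      (hcont z₀)).aestronglyMeasurable.mul (Lp.aestronglyMeasurable u))
    (Eventually.of_forall fun θ z hz => by
      rw [norm_mul]
      gcongr
      exact hbd θ z hz)
    (((memLp_exp_neg_sq_div_two z₀.re).const_mul C).integrable_mul (Lp.memLp u).norm)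
    (Eventually.of_forall fun θ z _ => (hasDerivAt_gauss_left z θ).mul_const (u θ))
  exact key.2.differentiableAt

/-- After `ab ≤ a² + b²`, translation invariance makes the integral of the squared Gaussian
independent of `z.re`. -/
theorem exists_norm_gaussTransform_le (u : L2) (M : ℝ) :
    ∃ B, ∀ z : ℂ, |z.im| ≤ M → ‖gaussTransform u z‖ ≤ B := by
  have hi1 : Integrable fun θ : ℝ => Real.exp (-θ ^ 2) ^ 2 := by
    have := (memLp_exp_neg_sq 0).integrable_sq
    simpa using this
  have hi2 : Integrable fun θ : ℝ => ‖u θ‖ ^ 2 := (Lp.memLp u).norm.integrable_sq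
  refine ⟨Real.exp (M ^ 2) * ((∫ θ : ℝ, Real.exp (-θ ^ 2) ^ 2) + ∫ θ : ℝ, ‖u θ‖ ^ 2),
    fun z hz => ?_⟩
  have h1 : ∫ θ : ℝ, Real.exp (-θ ^ 2) ^ 2 = ∫ θ : ℝ, Real.exp (-(θ - z.re) ^ 2) ^ 2 :=
    (integral_sub_right_eq_self (fun θ : ℝ => Real.exp (-θ ^ 2) ^ 2) z.re).symm
  have hi3 : Integrable fun θ : ℝ => Real.exp (-(θ - z.re) ^ 2) ^ 2 := hi1.comp_sub_right z.re
  rw [h1, ← integral_add hi3 hi2, ← integral_const_mul]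
  refine norm_integral_le_of_norm_le ((hi3.add hi2).const_mul _) (Eventually.of_forall fun θ => ?_)
  have h2 := norm_slice_gauss_le z (M := M) (y := 0) (by simpa using hz) θ
  have h3 : slice (gauss z) 0 θ = gauss z θ := by simp [slice]
  rw [h3] at h2
  rw [norm_mul]
  calc ‖gauss z θ‖ * ‖u θ‖ ≤ Real.exp (M ^ 2) * Real.exp (-(θ - z.re) ^ 2) * ‖u θ‖ := by gcongr
    _ ≤ _ := by
      rw [mul_assoc]
      gcongr
      nlinarith [sq_nonneg (Real.exp (-(θ - z.re) ^ 2) - ‖u θ‖),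
        sq_nonneg (Real.exp (-(θ - z.re) ^ 2)), sq_nonneg ‖u θ‖]

/-- The Gaussian transform is injective. -/
theorem eq_zero_of_gaussTransform_eq_zero {u : L2} (h : ∀ z, gaussTransform u z = 0) : u = 0 := by
  set v : ℝ → ℂ := fun θ => gauss 0 θ * u θ with hv
  have hvi : Integrable v := integrable_gauss_mul u 0
  have hF : ∀ ξ : ℝ, FourierTransform.fourier v ξ = 0 := by
    intro ξ
    -- For an imaginary centre, completing the square turns the Gaussian into the Fourier kernel
    -- times `exp(-θ²)`, up to a constant.
    have h1 := h (-Real.pi * Complex.I * ξ)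
    rw [Real.fourier_real_eq_integral_exp_smul]
    have h2 : ∀ θ : ℝ, Complex.exp (↑(-2 * Real.pi * θ * ξ) * Complex.I) • v θ =
        Complex.exp ((-Real.pi * Complex.I * ξ) ^ 2) *
          (gauss (-Real.pi * Complex.I * ξ) θ * u θ) := by
      intro θ
      simp only [hv, smul_eq_mul, gauss]
      rw [← mul_assoc, ← mul_assoc, ← Complex.exp_add,
        ← Complex.exp_add]
      congr 2
      push_cast
      ring
    simp_rw [h2]
    rw [integral_const_mul]
    rw [gaussTransform] at h1
    rw [h1, mul_zero]
  -- Each test function is the Fourier transform of a Schwartz function, so its pairing with `v` is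
  -- a pairing with the vanishing transform of `v`.
  have hv0 : ∀ᵐ θ, v θ = 0 := by
    refine ae_eq_zero_of_integral_contDiff_smul_eq_zero hvi.locallyIntegrable fun g hg hgc => ?_
    have hg₁ : HasCompactSupport (Complex.ofRealCLM ∘ g) := hgc.comp_left rfl
    have hg₂ : ContDiff ℝ (⊤ : ℕ∞) (Complex.ofRealCLM ∘ g) := by fun_prop
    set φ : SchwartzMap ℝ ℂ := hg₁.toSchwartzMap hg₂ with hφ
    set ψ : SchwartzMap ℝ ℂ := FourierTransformInv.fourierInv φ with hψ
    have h1 : FourierTransform.fourier ψ = φ := FourierTransform.fourier_fourierInv_eq φ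
    have h2 : ∫ ξ, FourierTransform.fourier v ξ • ψ ξ =
        ∫ θ, v θ • FourierTransform.fourier (ψ : ℝ → ℂ) θ := by
      simpa using! VectorFourier.integral_fourierIntegral_smul_eq_flip (L := innerₗ ℝ)
        Real.continuous_fourierChar continuous_inner hvi ψ.integrable
    have h3 : ∀ θ, FourierTransform.fourier (ψ : ℝ → ℂ) θ = (g θ : ℂ) := fun θ => by
      rw [← SchwartzMap.fourier_coe, h1]
      rfl
    simp only [hF, zero_smul, integral_zero, h3] at h2
    rw [h2]
    refine integral_congr_ae (Eventually.of_forall fun θ => ?_)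
    simp [mul_comm]
  rw [Lp.eq_zero_iff_ae_eq_zero]
  filter_upwards [hv0] with θ hθ
  exact (mul_eq_zero.1 hθ).resolve_left (Complex.exp_ne_zero _)

/-- A Gaussian transform that is quasi-periodic with a nontrivial phase vanishes. -/
theorem eq_zero_of_gaussTransform_sub_pi {u : L2} {c : ℂ} (hc : ‖c‖ = 1) (hc1 : c ≠ 1)
    (h : ∀ z, gaussTransform u (z - Real.pi * Complex.I) = c * gaussTransform u z) : u = 0 := by
  obtain ⟨B, hB⟩ := exists_norm_gaussTransform_le u Real.pi
  have hper : Function.Periodic (fun z => ‖gaussTransform u z‖) (Real.pi * Complex.I) := by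
    intro z
    have := h (z + Real.pi * Complex.I)
    rw [add_sub_cancel_right] at this
    simp only [this, norm_mul, hc, one_mul]
  have hbound : ∀ z, ‖gaussTransform u z‖ ≤ B := by
    intro z
    have h1 := hper.sub_zsmul_eq (x := z) ⌊z.im / Real.pi⌋
    rw [← h1]
    refine hB _ ?_
    have h2 : (z - ⌊z.im / Real.pi⌋ • (Real.pi * Complex.I)).im =
        z.im - ⌊z.im / Real.pi⌋ * Real.pi := by
      simp
    have h3 := Int.floor_le (z.im / Real.pi)
    have h4 := Int.lt_floor_add_one (z.im / Real.pi)
    rw [le_div_iff₀ Real.pi_pos] at h3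
    rw [div_lt_iff₀ Real.pi_pos] at h4
    rw [h2, abs_le]
    constructor <;> nlinarith [Real.pi_pos]
  have hconst := fun z w => (differentiable_gaussTransform u).apply_eq_apply_of_bounded
    (isBounded_iff_forall_norm_le.2 ⟨B, by rintro _ ⟨z, rfl⟩; exact hbound z⟩) z w
  refine eq_zero_of_gaussTransform_eq_zero fun z => ?_
  have h1 := h z
  rw [hconst (z - Real.pi * Complex.I) z] at h1
  have h2 : (1 - c) * gaussTransform u z = 0 := by linear_combination h1
  exact (mul_eq_zero.1 h2).resolve_left (sub_ne_zero.2 hc1.symm)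

/-! ### Contour shift and symmetry of the analytic continuation operator. -/

/-- Contour shift: the integral over a horizontal line does not depend on the line. -/
theorem integral_slice_eq {a b : ℝ} {g : ℂ → ℂ} (hg : DifferentiableOn ℂ g (strip a b))
    (hi : ∀ y ∈ Ioo a b, Integrable (slice g y))
    {C : ℝ} (hC : ∀ y ∈ Ioo a b, ∫ θ, ‖slice g y θ‖ ≤ C) {y₁ y₂ : ℝ}
    (h1 : y₁ ∈ Ioo a b) (h2 : y₂ ∈ Ioo a b) (h12 : y₁ ≤ y₂) :
    ∫ θ, slice g y₁ θ = ∫ θ, slice g y₂ θ := by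
  set ν : Measure ℝ := volume.restrict (Ioc y₁ y₂) with hν
  have hsub : Ioc y₁ y₂ ⊆ Ioo a b := fun y hy => ⟨h1.1.trans hy.1, hy.2.trans_lt h2.2⟩
  have hmeas : AEStronglyMeasurable (fun p : ℝ × ℝ => slice g p.2 p.1) (volume.prod ν) := by
    have hc : ContinuousOn (fun p : ℝ × ℝ => slice g p.2 p.1) (univ ×ˢ Ioc y₁ y₂) := by
      refine hg.continuousOn.comp (by fun_prop) fun p hp => ?_
      simpa [strip] using hsub hp.2
    have := hc.aestronglyMeasurable (μ := volume.prod volume)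
      (MeasurableSet.univ.prod measurableSet_Ioc)
    rwa [← Measure.prod_restrict, Measure.restrict_univ] at this
  have hmem : ∀ᵐ y ∂ν, y ∈ Ioc y₁ y₂ := ae_restrict_mem measurableSet_Ioc
  have hprod : Integrable (fun p : ℝ × ℝ => slice g p.2 p.1) (volume.prod ν) := by
    rw [integrable_prod_iff' hmeas]
    refine ⟨?_, ?_⟩
    · filter_upwards [hmem] with y hy using hi y (hsub hy)
    · refine Integrable.of_bound hmeas.norm.prod_swap.integral_prod_right' C ?_
      filter_upwards [hmem] with y hy
      rw [Real.norm_of_nonneg (integral_nonneg fun _ => norm_nonneg _)]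
      exact hC y (hsub hy)
  -- The vertical sides need no pointwise decay: by Fubini and the uniform L¹ bound, `V` is
  -- integrable in `R`. The difference of truncated integrals is thus integrable in `R` and
  -- convergent, which forces the limit zero.
  set V : ℝ → ℂ := fun R => ∫ y in y₁..y₂, slice g y R with hV
  have hVi : Integrable V := by
    have := hprod.integral_prod_left
    refine this.congr (Eventually.of_forall fun R => ?_)
    simp only [hV, intervalIntegral.integral_of_le h12]
    rfl
  have hrect : ∀ R : ℝ, (∫ θ in -R..R, slice g y₁ θ) - (∫ θ in -R..R, slice g y₂ θ) =
      -(Complex.I * (V R - V (-R))) := by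
    intro R
    have := Complex.integral_boundary_rect_eq_zero_of_differentiableOn g
      ((-R : ℝ) + y₁ * Complex.I) ((R : ℝ) + y₂ * Complex.I) (hg.mono fun z hz => by
        have h3 := hz.2
        simp only [mem_preimage, Complex.add_im, Complex.ofReal_im, Complex.mul_im,
          Complex.ofReal_re, Complex.I_im, mul_one, Complex.I_re, mul_zero, add_zero, zero_add,
          uIcc_of_le h12] at h3
        exact ⟨h1.1.trans_le h3.1, h3.2.trans_lt h2.2⟩)
    simp only [Complex.add_im, Complex.ofReal_im, Complex.mul_im,
          Complex.ofReal_re, Complex.I_im, mul_one, Complex.I_re, mul_zero, add_zero, zero_add,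
          Complex.add_re, Complex.mul_re, sub_self, smul_eq_mul] at this
    simp only [slice, hV]
    linear_combination this
  have hlim : Tendsto (fun R : ℝ => (∫ θ in -R..R, slice g y₁ θ) - (∫ θ in -R..R, slice g y₂ θ))
      atTop (𝓝 ((∫ θ, slice g y₁ θ) - ∫ θ, slice g y₂ θ)) :=
    (intervalIntegral_tendsto_integral (hi y₁ h1) tendsto_neg_atTop_atBot tendsto_id).sub
      (intervalIntegral_tendsto_integral (hi y₂ h2) tendsto_neg_atTop_atBot tendsto_id)
  have hint : Integrable fun R : ℝ =>
      (∫ θ in -R..R, slice g y₁ θ) - (∫ θ in -R..R, slice g y₂ θ) := by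
    simp only [hrect]
    exact ((hVi.sub hVi.comp_neg).const_mul _).neg
  refine sub_eq_zero.1 (IntegrableAtFilter.eq_zero_of_tendsto
    (hint.integrableAtFilter atTop) (fun s hs => ?_) hlim)
  obtain ⟨R, hR⟩ := mem_atTop_sets.1 hs
  exact top_le_iff.1 (Real.volume_Ici (a := R) ▸ measure_mono (fun x hx => hR x hx))

open Classical in
/-- The horizontal slice as an element of `L²(ℝ)`. -/
def sliceLp (ξ : ℂ → ℂ) (y : ℝ) : L2 :=
  if h : MemLp (slice ξ y) 2 volume then h.toLp else 0

theorem coeFn_sliceLp {ξ : ℂ → ℂ} {y : ℝ} (h : MemLp (slice ξ y) 2 volume) :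
    sliceLp ξ y =ᵐ[volume] slice ξ y := by
  rw [sliceLp, dif_pos h]
  exact h.coeFn_toLp

theorem SliceTendsto.tendsto_sliceLp {ξ : ℂ → ℂ} {l : Filter ℝ} {u : L2}
    (h : SliceTendsto ξ l u) (hm : ∀ᶠ y in l, MemLp (slice ξ y) 2 volume) :
    Tendsto (sliceLp ξ) l (𝓝 u) := by
  rw [tendsto_iff_edist_tendsto_0]
  refine Tendsto.congr' ?_ h
  filter_upwards [hm] with y hy
  rw [Lp.edist_def]
  refine eLpNorm_congr_ae ?_
  filter_upwards [coeFn_sliceLp hy] with θ hθ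
  simp [hθ]

theorem reflect_mem {a y : ℝ} (hy : y ∈ Ioo (-a) 0) : -a - y ∈ Ioo (-a) 0 :=
  ⟨by linarith [hy.2], by linarith [hy.1]⟩

/-- The reflected conjugate `z ↦ conj ξ(conj z - πi)` is analytic. -/
theorem differentiableOn_reflect {ξ : ℂ → ℂ} (h : DifferentiableOn ℂ ξ (strip (-Real.pi) 0)) :
    DifferentiableOn ℂ (fun z => starRingEnd ℂ (ξ (starRingEnd ℂ z - Real.pi * Complex.I)))
      (strip (-Real.pi) 0) := by
  intro z hz
  have hz' : starRingEnd ℂ z - Real.pi * Complex.I ∈ strip (-Real.pi) 0 := by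
    obtain ⟨h1, h2⟩ := hz
    constructor <;> simp <;> linarith
  have h1 := h.differentiableAt ((isOpen_strip _ _).mem_nhds hz')
  have h2 : DifferentiableAt ℂ (fun w => ξ (w - Real.pi * Complex.I)) (starRingEnd ℂ z) :=
    h1.comp (starRingEnd ℂ z) (f := fun w => w - Real.pi * Complex.I) (by fun_prop)
  have h3 := h2.conj_conj
  rw [Complex.conj_conj] at h3
  exact h3.differentiableWithinAt

theorem slice_reflect (ξ : ℂ → ℂ) (y θ : ℝ) :
    slice (fun z => starRingEnd ℂ (ξ (starRingEnd ℂ z - Real.pi * Complex.I))) y θ =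
      starRingEnd ℂ (slice ξ (-Real.pi - y) θ) := by
  simp only [slice]
  congr 2
  simp
  ring

/-- The operator `Δ^{1/2}` is symmetric. -/
theorem inner_shift_symm {u v u' v' : L2} (h : IsBoundaryPair u v) (h' : IsBoundaryPair u' v') :
    inner ℂ v u' = inner ℂ u v' := by
  obtain ⟨ξ, hξ, hu, hv⟩ := h
  obtain ⟨η, hη, hu', hv'⟩ := h'
  obtain ⟨C, hC, hCξ⟩ := hξ.bounded
  obtain ⟨D, hD, hDη⟩ := hη.bounded
  -- The slice of `g` at height `y` pairs `ξ` at height `-π - y` with `η` at height `y`; the two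
  -- ends of the strip give the two inner products.
  set g : ℂ → ℂ := fun z => starRingEnd ℂ (ξ (starRingEnd ℂ z - Real.pi * Complex.I)) * η z
    with hg
  have hgd : DifferentiableOn ℂ g (strip (-Real.pi) 0) :=
    (differentiableOn_reflect hξ.analytic).mul hη.analytic
  have hgs : ∀ y θ, slice g y θ = starRingEnd ℂ (slice ξ (-Real.pi - y) θ) * slice η y θ :=
    fun y θ => by rw [← slice_reflect]; rfl
  have hξm : ∀ y ∈ Ioo (-Real.pi) 0,
      MemLp (fun θ => starRingEnd ℂ (slice ξ (-Real.pi - y) θ)) 2 volume := fun y hy =>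
    (hξ.memLp _ (reflect_mem hy)).star
  have hgi : ∀ y ∈ Ioo (-Real.pi) 0, Integrable (slice g y) := fun y hy => by
    have := (hξm y hy).integrable_mul (hη.memLp y hy)
    exact this.congr (Eventually.of_forall fun θ => (hgs y θ).symm)
  have hgb : ∀ y ∈ Ioo (-Real.pi) 0, ∫ θ, ‖slice g y θ‖ ≤ (C * D).toReal := fun y hy => by
    rw [integral_norm_eq_lintegral_enorm (hgi y hy).1, ← eLpNorm_one_eq_lintegral_enorm]
    refine ENNReal.toReal_mono (ENNReal.mul_ne_top hC hD) ?_
    have h1 := eLpNorm_smul_le_mul_eLpNorm (p := 2) (q := 2) (r := 1) (hη.memLp y hy).1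
      (hξm y hy).1
    have h2 : (fun θ => starRingEnd ℂ (slice ξ (-Real.pi - y) θ)) • slice η y = slice g y := by
      ext θ; exact (hgs y θ).symm
    rw [h2] at h1
    refine h1.trans (mul_le_mul' ?_ (hDη y hy))
    refine le_trans (le_of_eq ?_) (hCξ _ (reflect_mem hy))
    exact eLpNorm_congr_norm_ae (Eventually.of_forall fun θ => by simp)
  have hconst : ∀ y ∈ Ioo (-Real.pi) 0, ∫ θ, slice g y θ = ∫ θ, slice g (-Real.pi / 2) θ := by
    intro y hy
    have hm : -Real.pi / 2 ∈ Ioo (-Real.pi) 0 := by constructor <;> linarith [Real.pi_pos]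
    rcases le_total y (-Real.pi / 2) with hle | hle
    · exact integral_slice_eq hgd hgi hgb hy hm hle
    · exact (integral_slice_eq hgd hgi hgb hm hy hle).symm
  have hinner : ∀ y ∈ Ioo (-Real.pi) 0, inner ℂ (sliceLp ξ (-Real.pi - y)) (sliceLp η y) =
      ∫ θ, slice g (-Real.pi / 2) θ := by
    intro y hy
    rw [← hconst y hy, L2.inner_def]
    refine integral_congr_ae ?_
    filter_upwards [coeFn_sliceLp (hξ.memLp _ (reflect_mem hy)), coeFn_sliceLp (hη.memLp _ hy)]
      with θ h1 h2
    rw [h1, h2, RCLike.inner_apply', hgs]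
  have hrefl_top : Tendsto (fun y => -Real.pi - y) (𝓝[<] 0) (𝓝[>] (-Real.pi)) := by
    refine tendsto_nhdsWithin_iff.2 ⟨?_, ?_⟩
    · refine tendsto_nhdsWithin_of_tendsto_nhds ?_
      have : Continuous fun y => -Real.pi - y := by fun_prop
      simpa using this.tendsto 0
    · filter_upwards [self_mem_nhdsWithin] with y hy
      simpa using hy
  have hrefl_bot : Tendsto (fun y => -Real.pi - y) (𝓝[>] (-Real.pi)) (𝓝[<] 0) := by
    refine tendsto_nhdsWithin_iff.2 ⟨?_, ?_⟩
    · refine tendsto_nhdsWithin_of_tendsto_nhds ?_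
      have : Continuous fun y => -Real.pi - y := by fun_prop
      simpa using this.tendsto (-Real.pi)
    · filter_upwards [self_mem_nhdsWithin] with y hy
      have : -Real.pi < y := hy
      simp only [mem_Iio]
      linarith
  have hLu := hu.tendsto_sliceLp (eventually_top.mono hξ.memLp)
  have hLv := hv.tendsto_sliceLp (eventually_bot.mono hξ.memLp)
  have hLu' := hu'.tendsto_sliceLp (eventually_top.mono hη.memLp)
  have hLv' := hv'.tendsto_sliceLp (eventually_bot.mono hη.memLp)
  have e1 : inner ℂ v u' = ∫ θ, slice g (-Real.pi / 2) θ :=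
    tendsto_nhds_unique ((hLv.comp hrefl_top).inner hLu')
      (tendsto_const_nhds.congr' (eventually_top.mono fun y hy => (hinner y hy).symm))
  have e2 : inner ℂ u v' = ∫ θ, slice g (-Real.pi / 2) θ :=
    tendsto_nhds_unique ((hLu.comp hrefl_bot).inner hLv')
      (tendsto_const_nhds.congr' (eventually_bot.mono fun y hy => (hinner y hy).symm))
  rw [e1, e2]

/-! ### Multiplication of the Hardy space by bounded analytic functions. -/

theorem mem_strip_slice {a b y : ℝ} (hy : y ∈ Ioo a b) (θ : ℝ) :
    (θ + y * Complex.I : ℂ) ∈ strip a b := by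
  simpa [strip] using hy

theorem continuous_slice {a b y : ℝ} {f : ℂ → ℂ} (hf : DifferentiableOn ℂ f (strip a b))
    (hy : y ∈ Ioo a b) : Continuous (slice f y) :=
  hf.continuousOn.comp_continuous (by fun_prop) (mem_strip_slice hy)

theorem IsHardyInfty.ae_tendsto_upperBoundary {f : ℂ → ℂ} (hf : IsHardyInfty (-Real.pi) 0 f) :
    ∀ᵐ θ : ℝ, Tendsto (fun y => slice f y θ) (𝓝[<] 0) (𝓝 (upperBoundary f θ)) := by
  filter_upwards [hf.ae_tendsto_upper (neg_lt_zero.2 Real.pi_pos)] with θ hθ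
  exact tendsto_nhds_limUnder hθ

/-- The analytic map `z ↦ -z - πi` exchanges the two edges, reducing to the upper edge; null sets
are carried along by `θ ↦ -θ`. -/
theorem IsHardyInfty.ae_tendsto_lowerBoundary {f : ℂ → ℂ} (hf : IsHardyInfty (-Real.pi) 0 f) :
    ∀ᵐ θ : ℝ, Tendsto (fun y => slice f y θ) (𝓝[>] (-Real.pi)) (𝓝 (lowerBoundary f θ)) := by
  have hmaps : MapsTo (fun z : ℂ => -z - Real.pi * Complex.I) (strip (-Real.pi) 0)
      (strip (-Real.pi) 0) := fun z hz => by
    obtain ⟨h1, h2⟩ := hz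
    constructor <;> simp <;> linarith
  have hg : IsHardyInfty (-Real.pi) 0 fun z => f (-z - Real.pi * Complex.I) := by
    obtain ⟨C, hC⟩ := hf.bounded
    exact ⟨hf.analytic.comp (by fun_prop) hmaps, C, fun z hz => hC _ (hmaps hz)⟩
  have hrefl : Tendsto (fun y => -Real.pi - y) (𝓝[>] (-Real.pi)) (𝓝[<] 0) := by
    refine tendsto_nhdsWithin_iff.2 ⟨tendsto_nhdsWithin_of_tendsto_nhds ?_, ?_⟩
    · have : Continuous fun y => -Real.pi - y := by fun_prop
      simpa using this.tendsto (-Real.pi)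
    · filter_upwards [self_mem_nhdsWithin] with y hy
      have : -Real.pi < y := hy
      simp only [mem_Iio]
      linarith
  filter_upwards [(Measure.measurePreserving_neg (volume : Measure ℝ)).quasiMeasurePreserving.ae
    (hg.ae_tendsto_upper (neg_lt_zero.2 Real.pi_pos))] with θ hθ
  obtain ⟨c, hc⟩ := hθ
  refine tendsto_nhds_limUnder ⟨c, (hc.comp hrefl).congr fun y => ?_⟩
  simp only [Function.comp, slice]
  congr 1
  push_cast
  ring

/-- Products of slices of a bounded function and of an `H²` function converge in `L²`. -/
theorem SliceTendsto.mul_bounded {f ξ : ℂ → ℂ} {l : Filter ℝ} [l.IsCountablyGenerated] [l.NeBot]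
    {u w : L2} {m : ℝ → ℂ} (hf : IsHardyInfty (-Real.pi) 0 f) (hξ : IsHardyTwo (-Real.pi) 0 ξ)
    (hl : ∀ᶠ y in l, y ∈ Ioo (-Real.pi) 0) (hu : SliceTendsto ξ l u)
    (hm : ∀ᵐ θ : ℝ, Tendsto (fun y => slice f y θ) l (𝓝 (m θ)))
    (hw : w =ᵐ[volume] fun θ => m θ * u θ) : SliceTendsto (f * ξ) l w := by
  obtain ⟨C, hC⟩ := hf.bounded
  have hfm : ∀ᶠ y in l, AEStronglyMeasurable (slice f y) volume :=
    hl.mono fun y hy => (continuous_slice hf.analytic hy).aestronglyMeasurable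
  have hmm : AEStronglyMeasurable m volume := by
    obtain ⟨s, hs⟩ := l.exists_seq_tendsto
    obtain ⟨N, hN⟩ := eventually_atTop.1 (hs.eventually hfm)
    refine aestronglyMeasurable_of_tendsto_ae atTop (f := fun n => slice f (s (n + N)))
      (fun n => hN _ (Nat.le_add_left _ _)) ?_
    filter_upwards [hm] with θ hθ
    exact (hθ.comp hs).comp (tendsto_add_atTop_nat N)
  have hmC : ∀ᵐ θ, ‖m θ‖ ≤ C := by
    filter_upwards [hm] with θ hθ
    exact le_of_tendsto hθ.norm (hl.mono fun y hy => hC _ (mem_strip_slice hy θ))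
  -- Split `fξ - mu = f(ξ - u) + (f - m)u`: boundedness of `f` handles the first term, dominated
  -- convergence the second.
  have h1 : Tendsto (fun y => ENNReal.ofReal C * eLpNorm (fun θ => slice ξ y θ - u θ) 2 volume) l
      (𝓝 0) := by
    simpa using ENNReal.Tendsto.const_mul (a := ENNReal.ofReal C) hu (Or.inr ENNReal.ofReal_ne_top)
  have h2 : Tendsto (fun y => eLpNorm (fun θ => (slice f y θ - m θ) * u θ) 2 volume) l (𝓝 0) := by
    refine tendsto_eLpNorm_two_zero_of_dominated (H := fun θ => (C + C) * ‖u θ‖) ?_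
      ((Lp.memLp u).norm.const_mul _) ?_ ?_
    · filter_upwards [hfm] with y hy using (hy.sub hmm).mul (Lp.aestronglyMeasurable u)
    · filter_upwards [hl] with y hy
      filter_upwards [hmC] with θ hθ
      rw [norm_mul]
      gcongr
      exact (norm_sub_le _ _).trans (add_le_add (hC _ (mem_strip_slice hy θ)) hθ)
    · filter_upwards [hm] with θ hθ
      simpa using (hθ.sub_const (m θ)).mul_const (u θ)
  have h3 := h1.add h2
  rw [add_zero] at h3
  refine tendsto_of_tendsto_of_tendsto_of_le_of_le' tendsto_const_nhds h3
    (Eventually.of_forall fun _ => zero_le) ?_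
  filter_upwards [hl, hfm] with y hy hym
  have hsub := memLp_slice_sub hξ hy u
  calc eLpNorm (fun θ => slice (f * ξ) y θ - w θ) 2 volume
      = eLpNorm ((fun θ => slice f y θ * (slice ξ y θ - u θ)) +
          fun θ => (slice f y θ - m θ) * u θ) 2 volume := by
        refine eLpNorm_congr_ae ?_
        filter_upwards [hw] with θ hθ
        rw [hθ]
        simp only [slice, Pi.mul_apply, Pi.add_apply]
        ring
    _ ≤ eLpNorm (fun θ => slice f y θ * (slice ξ y θ - u θ)) 2 volume +
          eLpNorm (fun θ => (slice f y θ - m θ) * u θ) 2 volume :=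
        eLpNorm_add_le (hym.mul hsub.1) ((hym.sub hmm).mul (Lp.aestronglyMeasurable u))
          (by norm_num)
    _ ≤ _ := by
        gcongr
        refine eLpNorm_le_mul_eLpNorm_of_ae_le_mul (Eventually.of_forall fun θ => ?_) 2
        rw [norm_mul]
        gcongr
        exact hC _ (mem_strip_slice hy θ)

theorem IsHardyTwo.mul_bounded {a b : ℝ} {f ξ : ℂ → ℂ} (hf : IsHardyInfty a b f)
    (hξ : IsHardyTwo a b ξ) : IsHardyTwo a b (f * ξ) := by
  obtain ⟨C, hC⟩ := hf.bounded
  obtain ⟨D, hD, hDξ⟩ := hξ.bounded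
  have hle : ∀ y ∈ Ioo a b, ∀ θ, ‖slice (f * ξ) y θ‖ ≤ C * ‖slice ξ y θ‖ := fun y hy θ => by
    have : slice (f * ξ) y θ = slice f y θ * slice ξ y θ := rfl
    rw [this, norm_mul]
    gcongr
    exact hC _ (mem_strip_slice hy θ)
  refine ⟨hf.analytic.mul hξ.analytic, fun y hy => ?_, ENNReal.ofReal C * D,
    ENNReal.mul_ne_top ENNReal.ofReal_ne_top hD, fun y hy => ?_⟩
  · exact (hξ.memLp y hy).of_le_mul
      (continuous_slice (hf.analytic.mul hξ.analytic) hy).aestronglyMeasurable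
      (Eventually.of_forall (hle y hy))
  · refine (eLpNorm_le_mul_eLpNorm_of_ae_le_mul (Eventually.of_forall (hle y hy)) 2).trans ?_
    gcongr
    exact hDξ y hy

/-- Multiplication by a bounded analytic function preserves the Hardy space, and commutes with the
boundary values. -/
theorem IsBoundaryPair.mul_bounded {f : ℂ → ℂ} (hf : IsHardyInfty (-Real.pi) 0 f)
    {u v u' v' : L2} (h : IsBoundaryPair u v)
    (hu : u' =ᵐ[volume] fun θ => upperBoundary f θ * u θ)
    (hv : v' =ᵐ[volume] fun θ => lowerBoundary f θ * v θ) : IsBoundaryPair u' v' := by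
  obtain ⟨ξ, hξ, h1, h2⟩ := h
  exact ⟨f * ξ, hξ.mul_bounded hf,
    h1.mul_bounded hf hξ eventually_top hf.ae_tendsto_upperBoundary hu,
    h2.mul_bounded hf hξ eventually_bot hf.ae_tendsto_lowerBoundary hv⟩

/-- Multiplication by the boundary value of a bounded analytic function preserves `L²`. -/
theorem memLp_upperBoundary_mul {f : ℂ → ℂ} (hf : IsHardyInfty (-Real.pi) 0 f) (u : L2) :
    MemLp (fun θ => upperBoundary f θ * u θ) 2 volume := by
  obtain ⟨C, hC⟩ := hf.bounded
  have hm : AEStronglyMeasurable (upperBoundary f) volume := by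
    obtain ⟨s, hs⟩ := (𝓝[<] (0 : ℝ)).exists_seq_tendsto
    obtain ⟨N, hN⟩ := eventually_atTop.1 (hs.eventually eventually_top)
    refine aestronglyMeasurable_of_tendsto_ae atTop (f := fun n => slice f (s (n + N)))
      (fun n => (continuous_slice hf.analytic (hN _ (Nat.le_add_left _ _))).aestronglyMeasurable) ?_
    filter_upwards [hf.ae_tendsto_upperBoundary] with θ hθ
    exact (hθ.comp hs).comp (tendsto_add_atTop_nat N)
  refine (Lp.memLp u).of_le_mul (c := C) (hm.mul (Lp.aestronglyMeasurable u)) ?_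
  filter_upwards [hf.ae_tendsto_upperBoundary] with θ hθ
  rw [norm_mul]
  gcongr
  exact le_of_tendsto hθ.norm (eventually_top.mono fun y hy => hC _ (mem_strip_slice hy θ))

/-- Boundedness of `f` makes the multiplier everywhere defined, so the product operator has all of
H² as its domain. -/
theorem mem_domain_mulOp_conj {f : ℂ → ℂ} (hf : IsHardyInfty (-Real.pi) 0 f) (u : L2) :
    u ∈ (mulOp fun θ => starRingEnd ℂ (upperBoundary f θ)).domain := by
  have h1 := (memLp_upperBoundary_mul hf (star u)).star
  refine h1.ae_eq ?_
  filter_upwards [Lp.coeFn_star u] with θ hθ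
  simp only [Pi.star_apply, hθ, star_mul', RCLike.star_def, Complex.conj_conj]

/-! ### Symmetry, density and the relative bound for the operator. -/

section Operator

variable (f : ℂ → ℂ)

/-- The restriction of `Δ^{1/2}` to the domain of `M_{f̄} Δ^{1/2}`. -/
def sqrtDeltaRestrict : (boundStateOp f).domain →ₗ[ℂ] L2 :=
  sqrtDelta.toFun ∘ₗ Submodule.inclusion fun _ hx => hx.1

theorem isBoundaryPair_sqrtDeltaRestrict (x : (boundStateOp f).domain) :
    IsBoundaryPair x (sqrtDeltaRestrict f x) :=
  (mem_graph_sqrtDelta _ _).1 (sqrtDelta.mem_graph ⟨x, x.2.1⟩)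

theorem coeFn_boundStateOp (x : (boundStateOp f).domain) :
    boundStateOp f x =ᵐ[volume]
      fun θ => starRingEnd ℂ (upperBoundary f θ) * sqrtDeltaRestrict f x θ :=
  MemLp.coeFn_toLp (hf := x.2.2)

variable {f}

theorem exists_domain_of_isBoundaryPair (hf : IsHardyInfty (-Real.pi) 0 f) {u v : L2}
    (h : IsBoundaryPair u v) :
    ∃ x : (boundStateOp f).domain, (x : L2) = u ∧ sqrtDeltaRestrict f x = v := by
  obtain ⟨y, hy, hyv⟩ := (LinearPMap.mem_graph_iff _).1 ((mem_graph_sqrtDelta u v).2 h)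
  exact ⟨⟨y, y.2, mem_domain_mulOp_conj hf _⟩, hy, hyv⟩

/-- The operator `M_{f̄} Δ^{1/2}` is symmetric. -/
theorem boundStateOp_symm (hf : IsHardyInfty (-Real.pi) 0 f)
    (hsymm : ∀ᵐ θ : ℝ, starRingEnd ℂ (upperBoundary f θ) = lowerBoundary f θ)
    (x y : (boundStateOp f).domain) :
    inner ℂ (boundStateOp f x) (y : L2) = inner ℂ (x : L2) (boundStateOp f y) := by
  set w : L2 := (memLp_upperBoundary_mul hf (y : L2)).toLp with hw
  have hwc := (memLp_upperBoundary_mul hf (y : L2)).coeFn_toLp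
  -- The product of `f` with the Hardy function of `y` has lower boundary value `f(θ - πi)` times
  -- that of `y`, which the reflection condition turns into multiplication by `conj f(θ)`.
  have hpair : IsBoundaryPair w (boundStateOp f y) := by
    refine (isBoundaryPair_sqrtDeltaRestrict f y).mul_bounded hf hwc ?_
    filter_upwards [coeFn_boundStateOp f y, hsymm] with θ h1 h2
    rw [h1, h2]
  rw [← inner_shift_symm (isBoundaryPair_sqrtDeltaRestrict f x) hpair, L2.inner_def, L2.inner_def]
  refine integral_congr_ae ?_
  filter_upwards [coeFn_boundStateOp f x, hwc] with θ h1 h2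
  rw [h1, hw, h2, RCLike.inner_apply', RCLike.inner_apply', map_mul, Complex.conj_conj]
  ring

/-- The domain contains all Gaussians, and a vector orthogonal to them has vanishing Gaussian
transform. -/
theorem denseRange_subtype_boundStateOp (hf : IsHardyInfty (-Real.pi) 0 f) :
    DenseRange (boundStateOp f).domain.subtype := by
  refine denseRange_of_inner_eq_zero _ fun u hu =>
    eq_zero_of_gaussTransform_eq_zero fun z => ?_
  obtain ⟨x, hx, -⟩ := exists_domain_of_isBoundaryPair hf
    (isBoundaryPair_gauss (starRingEnd ℂ z))
  have h1 := hu x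
  rw [Submodule.subtype_apply, hx, inner_gaussSlice] at h1
  simpa using h1

/-- The operator `r Δ^{1/2} ± ir` has dense range. -/
theorem denseRange_sqrtDelta_add (hf : IsHardyInfty (-Real.pi) 0 f) {r ν : ℝ} (hr : 0 < r)
    (hν : |ν| = |r|) :
    DenseRange ((r : ℂ) • sqrtDeltaRestrict f + (ν * Complex.I) •
      (boundStateOp f).domain.subtype) := by
  have hrC : (r : ℂ) ≠ 0 := by exact_mod_cast hr.ne'
  -- Orthogonality to the Gaussians gives quasi-periodicity with phase `iν/r`: unimodular because
  -- `|ν| = |r|`, and different from `1` because it is imaginary.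
  refine denseRange_of_inner_eq_zero _ fun u hu =>
    eq_zero_of_gaussTransform_sub_pi (c := ν * Complex.I / r) ?_ ?_ fun z => ?_
  · rw [norm_div, norm_mul, Complex.norm_I, mul_one, Complex.norm_real, Complex.norm_real,
      Real.norm_eq_abs, Real.norm_eq_abs, hν, div_self (abs_pos.2 hr.ne').ne']
  · intro h
    rw [div_eq_one_iff_eq hrC] at h
    have := congrArg Complex.re h
    simp at this
    exact hr.ne this
  · obtain ⟨x, hx, hx'⟩ := exists_domain_of_isBoundaryPair hf
      (isBoundaryPair_gauss (starRingEnd ℂ z))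
    have h1 := hu x
    simp only [LinearMap.add_apply, LinearMap.smul_apply, Submodule.subtype_apply, hx, hx',
      inner_add_left, inner_smul_left, inner_gaussSlice, Complex.conj_conj, map_mul,
      Complex.conj_ofReal, Complex.conj_I, Complex.ofReal_zero, zero_mul, add_zero,
      Complex.ofReal_neg, neg_mul, ← sub_eq_add_neg] at h1
    field_simp
    linear_combination h1

/-- Pointwise, `|f̄ - r| ≤ r` multiplies the same function `Δ^{1/2}x`. This is where the disc
condition enters. -/
theorem norm_boundStateOp_sub_le {r : ℝ}
    (hle : ∀ᵐ θ : ℝ, ‖starRingEnd ℂ (upperBoundary f θ) - (r : ℂ)‖ ≤ r)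
    (x : (boundStateOp f).domain) :
    ‖((boundStateOp f).toFun - (r : ℂ) • sqrtDeltaRestrict f) x‖ ≤
      ‖((r : ℂ) • sqrtDeltaRestrict f) x‖ := by
  refine Lp.norm_le_norm_of_ae_le ?_
  filter_upwards [hle, coeFn_boundStateOp f x,
    Lp.coeFn_sub (boundStateOp f x) ((r : ℂ) • sqrtDeltaRestrict f x),
    Lp.coeFn_smul (r : ℂ) (sqrtDeltaRestrict f x)] with θ h1 h2 h3 h4
  change ‖(boundStateOp f x - (r : ℂ) • sqrtDeltaRestrict f x : L2) θ‖ ≤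
    ‖((r : ℂ) • sqrtDeltaRestrict f x : L2) θ‖
  rw [h3, Pi.sub_apply, h4, h2, Pi.smul_apply, smul_eq_mul, ← sub_mul, norm_mul, norm_mul]
  gcongr
  exact h1.trans (by rw [Complex.norm_real]; exact le_abs_self r)

end Operator

end BoundState

end

theorem mainTheorem10 (f : ℂ → ℂ) (hf : BoundState.IsHardyInfty (-Real.pi) 0 f)
    (hsymm : ∀ᵐ θ : ℝ, starRingEnd ℂ (BoundState.upperBoundary f θ) =
      BoundState.lowerBoundary f θ)
    (hr : ∃ r : ℝ, 0 < r ∧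
      ∀ᵐ θ : ℝ, ‖starRingEnd ℂ (BoundState.upperBoundary f θ) - (r : ℂ)‖ ≤ r) :
    BoundState.IsEssentiallySelfAdjoint (BoundState.boundStateOp f) := by
  obtain ⟨r, hr0, hle⟩ := hr
  have hJ := BoundState.denseRange_subtype_boundStateOp hf
  have hdense : Dense ((BoundState.boundStateOp f).domain : Set BoundState.L2) := by
    have := hJ
    rwa [DenseRange, Submodule.coe_subtype, Subtype.range_coe] at this
  have hT := BoundState.boundStateOp_symm hf hsymm
  have hA : ∀ x y : (BoundState.boundStateOp f).domain,
      inner ℂ (((r : ℂ) • BoundState.sqrtDeltaRestrict f) x) (y : BoundState.L2) =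
        inner ℂ (x : BoundState.L2) (((r : ℂ) • BoundState.sqrtDeltaRestrict f) y) := fun x y => by
    rw [LinearMap.smul_apply, LinearMap.smul_apply, inner_smul_left, inner_smul_right,
      Complex.conj_ofReal, BoundState.inner_shift_symm
        (BoundState.isBoundaryPair_sqrtDeltaRestrict f x)
        (BoundState.isBoundaryPair_sqrtDeltaRestrict f y)]
  have hB : ∀ x y : (BoundState.boundStateOp f).domain,
      inner ℂ (((BoundState.boundStateOp f).toFun - (r : ℂ) • BoundState.sqrtDeltaRestrict f) x)
        (y : BoundState.L2) = inner ℂ (x : BoundState.L2)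
        (((BoundState.boundStateOp f).toFun - (r : ℂ) • BoundState.sqrtDeltaRestrict f) y) :=
    fun x y => by
      rw [LinearMap.sub_apply, LinearMap.sub_apply, inner_sub_left, inner_sub_right, hA]
      exact congrArg (· - _) (hT x y)
  -- The choice `μ = r` matches the condition `|ν| = |r|` under which the range for `rΔ^{1/2}` is
  -- known to be dense.
  obtain ⟨h1, h2⟩ := LinearPMap.isClosable_and_adjoint_closure_eq hdense hT hr0.ne' fun ν hν => by
    have hν0 : ν ≠ 0 := abs_pos.1 (hν ▸ abs_pos.2 hr0.ne')
    have := denseRange_add_of_norm_le hJ (fun x => hA x x) hB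
      (BoundState.norm_boundStateOp_sub_le hle) hν0 (BoundState.denseRange_sqrtDelta_add hf hr0 hν)
    rwa [add_sub_cancel] at this
  exact ⟨hdense, hT, h1, h2⟩
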